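/- **Setting.** Let $\mathbb{D}$ be a countable set and $G\le \mathrm{Sym}(\mathbb{D})$. A $G$-set $X$ is *nominal* if every $z\in X$ has a finite support, i.e. a finite $C\subseteq\mathbb{D}$ such that every $\pi\in G$ fixing $C$ pointwise fixes $z$; it is *orbit finite* if it has finitely many orbits. Assume that $(\mathbb{D},G)$ admits least supports: every element of every nominal $G$-set has a finite support contained in all its finite supports. For $G$-sets, $Y\preceq X$ means that there is an equivariant surjection from an (equivariant) subset of $X$ onto $Y$; $Y\prec X$ means that $Y\preceq X$ and $X,Y$ are not isomorphic. Let $m\ge 0$ and let $A$ be a nominal orbit finite $G$-set. Trees over $A$ are the terms $a(t_1,\dots,t_k)$ with $a\in A$, $0\le k\le m$; contexts are terms with exactly one occurrence of a variable $x$ (fixed by $G$), as a leaf, and $c[t]$ is the result of replacing $x$ by $t$ in $c$. A *$G$-DBTA* $(Q,F,\delta)$ has a $G$-set $Q$ of states, an equivariant $F\subseteq Q$ and equivariant maps $\delta_k:A\times Q^k\to Q$ ($0\le k\le m$); it reads trees bottom-up and accepts $t$ iff $\delta(t)\in F$. It is a *$G$-DBNTA* if $A$ and $Q$ are orbit finite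 and nominal. We write $\mathcal{A}'\sqsubseteq\mathcal{A}$ if there are an equivariant set $P$ of states of $\mathcal{A}$, closed under the transitions, and an equivariant surjection from $P$ onto the states of $\mathcal{A}'$ that preserves and reflects acceptance and commutes with the transitions. Let $U$ be a language recognized by some $G$-DBNTA, and let $\mathcal{A}_U=(Q_U,F_U,\delta_U)$ be its syntactic automaton: $Q_U$ is the set of trees modulo $s\approx_U t\Leftrightarrow\forall c\,(c[s]\in U\Leftrightarrow c[t]\in U)$, $F_U=\{[t]\mid t\in U\}$, $\delta_U(a,[t_1],\dots,[t_k])=[a(t_1,\dots,t_k)]$. An *observation table* for $U$ consists of an equivariant, orbit finite, subtree-closed set $S$ of trees with $A\subseteq S$, an equivariant orbit finite set $E\ni x$ of contexts that is $x$-prefix-closed on $S$ (each $c\in E\setminus\{x\}$ is $c'[a(b_1,\dots,x,\dots,b_{k-1})]$ with $c'\in E$, $a\in A$, $b_j\in S$), and the map $T:E[S\cup \mathrm{Next}(S)]\to\{0,1\}$ with $T(t)=1\Leftrightarrow t\in U$, where $\mathrm{Next}(S)$ is the set of trees $a(s_1,\dots,s_k)\notin S$ with $a\in A$, $1\le k\le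 m$, $s_j\in S$. Put $\mathrm{row}(s)=\{e\in E\mid T(e[s])=1\}$ and $\mathrm{row}(S)=\{\mathrm{row}(s)\mid s\in S\}$. The table is *closed* if every $\mathrm{row}(t)$, $t\in\mathrm{Next}(S)$, lies in $\mathrm{row}(S)$; it is *consistent* if $\mathrm{row}(s_1)=\mathrm{row}(s_2)$ with $s_1,s_2\in S$ implies $\mathrm{row}(a(b_1,\dots,s_1,\dots,b_{k-1}))=\mathrm{row}(a(b_1,\dots,s_2,\dots,b_{k-1}))$ for all $a\in A$, $b_j\in S$, $1\le k\le m$ and all positions. A closed and consistent table defines an automaton $\mathcal{A}(S,E,T)$ with states $\mathrm{row}(S)$, accepting states $\mathrm{row}(s)$ with $s\in S$, $T(s)=1$, and transitions $(a,\mathrm{row}(s_1),\dots,\mathrm{row}(s_k))\mapsto\mathrm{row}(a(s_1,\dots,s_k))$ for $s_j\in S$. **Algorithm.** Start with $S=A$, $E=\{x\}$. While the table is not closed or not consistent, do: (i) if it is not consistent, choose $s_1,s_2,b_j\in S$, $e\in E$, $a\in A$ and a position with $\mathrm{row}(s_1)=\mathrm{row}(s_2)$ and $T(e[a(\dots,s_1,\dots)])\ne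 T(e[a(\dots,s_2,\dots)])$, and add the orbit of $e[a(b_1,\dots,x,\dots,b_{k-1})]$ to $E$; (ii) then, if the table is not closed, choose $s'\in\mathrm{Next}(S)$ with $\mathrm{row}(s')\notin\mathrm{row}(S)$ and add its orbit to $S$. When the loop is left, submit $\mathcal{A}(S,E,T)$ to the teacher. If it recognizes $U$, the teacher says yes and it is returned; otherwise the teacher returns an arbitrary tree $t$ on which $U$ and the conjecture differ, the orbits of all subtrees of $t$ are added to $S$, and the while loop is entered again. **Theorem.** For all choices of the learner and of the teacher: 1. The algorithm terminates: it has no infinite run, and it never gets stuck before returning an automaton. 2. The returned automaton $\mathcal{A}(S,E,T)$ is a $G$-DBNTA recognizing $U$, satisfies $\mathcal{A}(S,E,T)\sqsubseteq\mathcal{A}$ for every $G$-DBNTA $\mathcal{A}$ recognizing $U$, and is isomorphic to $\mathcal{A}_U$. 3. $\mathcal{A}_U$ is a $G$-DBNTA recognizing $U$, and $\mathrm{row}(S)\preceq Q_U$ for every observation table for $U$. 4. Each extension of type (i) or (ii) strictly increases $\mathrm{row}(S)$ with respect to $\prec$. An extension by a counterexample leads from $\mathrm{row}(S)$ to some $\mathrm{row}(S')$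 with $\mathrm{row}(S)\preceq\mathrm{row}(S')$, and $\mathrm{row}(S)\prec\mathrm{row}(S')$ if the new table is again closed and consistent. In particular $\mathrm{row}(S)$ strictly increases with respect to $\prec$ from each conjecture to every later conjecture. 5. Chains are finite: for every orbit finite nominal set $X$ there is an $N$ such that every chain $X_1\prec X_2\prec\dots\prec X_n$ of orbit finite nominal sets with $X_i\preceq X$ for all $i$ has $n\le N$. -/

import Mathlib

open scoped Pointwise

universe u v w w' x x'

namespace NominalTree

/-! ### `G`-sets

For a group `Γ`, a `Γ`-set is a type with `MulAction Γ`; equivariant subsets are `SubMulAction`s and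
equivariant functions are `→[Γ]`. Group actions are written on the left: with composition of
permutations in Mathlib's order (`(π * σ) d = π (σ d)`) left actions are the same thing as right
actions for the opposite composition order. -/

section GSets

variable {Γ : Type*} [Group Γ]

/-- A `Γ`-set with finitely many orbits. -/
def OrbitFinite (Γ : Type*) [Group Γ] (X : Type*) [MulAction Γ X] : Prop :=
  Finite (MulAction.orbitRel.Quotient Γ X)

/-- `NomLE Γ Y X` is `Y ≼ X`: there is an equivariant surjection from an (equivariant) subset of
`X` onto `Y`. -/
def NomLE (Γ : Type*) [Group Γ] (Y X : Type*) [MulAction Γ Y] [MulAction Γ X] : Prop :=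
  ∃ (P : SubMulAction Γ X) (f : P →[Γ] Y), Function.Surjective f

/-- Isomorphism of `Γ`-sets: there is an equivariant bijection. -/
def NomIso (Γ : Type*) [Group Γ] (Y X : Type*) [MulAction Γ Y] [MulAction Γ X] : Prop :=
  ∃ f : Y →[Γ] X, Function.Bijective f

/-- `NomLT Γ Y X` is `Y ≺ X`: `Y ≼ X`, and `Y`, `X` are not isomorphic. -/
def NomLT (Γ : Type*) [Group Γ] (Y X : Type*) [MulAction Γ Y] [MulAction Γ X] : Prop :=
  NomLE Γ Y X ∧ ¬ NomIso Γ Y X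

/-- `Orbit(F)`: the union of the orbits of the elements of `F`. -/
def orbitSpan (Γ : Type*) [Group Γ] {X : Type*} [MulAction Γ X] (F : Set X) :
    SubMulAction Γ X where
  carrier := {z | ∃ y ∈ F, ∃ g : Γ, g • y = z}
  smul_mem' := by
    rintro h z ⟨y, hy, g, rfl⟩
    exact ⟨y, hy, h * g, mul_smul h g y⟩

theorem orbitFinite_of_cover {X : Type*} [MulAction Γ X] {S : SubMulAction Γ X} {F : Set X}
    (hF : F.Finite) (h : ∀ z ∈ S, ∃ y ∈ F, ∃ g : Γ, g • y = z) : OrbitFinite Γ S := by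
  have hF' : Finite {y : S // (y : X) ∈ F} := by
    have := hF.to_subtype
    exact Finite.of_injective (fun y => (⟨y.1.1, y.2⟩ : F)) (by
      rintro ⟨⟨a, ha⟩, ha'⟩ ⟨⟨b, hb⟩, hb'⟩ hab
      simpa using hab)
  refine Finite.of_surjective
    (fun y : {y : S // (y : X) ∈ F} => (Quotient.mk _ y.1 : MulAction.orbitRel.Quotient Γ S)) ?_
  intro q
  obtain ⟨⟨z, hz⟩, rfl⟩ := Quotient.exists_rep q
  obtain ⟨y, hy, g, rfl⟩ := h z hz
  have hyS : y ∈ S := by simpa using S.smul_mem g⁻¹ hz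
  refine ⟨⟨⟨y, hyS⟩, hy⟩, Quotient.sound ?_⟩
  refine ⟨g⁻¹, ?_⟩
  ext
  simp

theorem exists_cover_of_orbitFinite {X : Type*} [MulAction Γ X] (h : OrbitFinite Γ X) :
    ∃ F : Set X, F.Finite ∧ ∀ z : X, ∃ y ∈ F, ∃ g : Γ, g • y = z := by
  have : Finite (MulAction.orbitRel.Quotient Γ X) := h
  refine ⟨Set.range (fun q : MulAction.orbitRel.Quotient Γ X => q.out), Set.finite_range _, ?_⟩
  intro z
  refine ⟨_, ⟨Quotient.mk _ z, rfl⟩, ?_⟩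
  have h1 : (MulAction.orbitRel Γ X) (Quotient.mk (MulAction.orbitRel Γ X) z).out z :=
    Quotient.mk_out z
  obtain ⟨g, hg⟩ := h1
  exact ⟨g⁻¹, inv_smul_eq_iff.2 hg.symm⟩

theorem orbitFinite_orbitSpan {X : Type*} [MulAction Γ X] {F : Set X} (hF : F.Finite) :
    OrbitFinite Γ (orbitSpan Γ F) :=
  orbitFinite_of_cover hF fun _ hz => hz

theorem mem_sup_iff {X : Type*} [MulAction Γ X] {S T : SubMulAction Γ X} {z : X} :
    z ∈ S ⊔ T ↔ z ∈ S ∨ z ∈ T := Iff.rfl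

theorem orbitFinite_sup {X : Type*} [MulAction Γ X] {S T : SubMulAction Γ X}
    (hS : OrbitFinite Γ S) (hT : OrbitFinite Γ T) : OrbitFinite Γ (S ⊔ T : SubMulAction Γ X) := by
  obtain ⟨F, hF, hF'⟩ := exists_cover_of_orbitFinite hS
  obtain ⟨F₂, hF₂, hF₂'⟩ := exists_cover_of_orbitFinite hT
  refine orbitFinite_of_cover ((hF.image Subtype.val).union (hF₂.image Subtype.val)) ?_
  intro z hz
  rcases mem_sup_iff.1 hz with hz | hz
  · obtain ⟨y, hy, g, hg⟩ := hF' ⟨z, hz⟩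
    exact ⟨y, Or.inl ⟨y, hy, rfl⟩, g, congrArg Subtype.val hg⟩
  · obtain ⟨y, hy, g, hg⟩ := hF₂' ⟨z, hz⟩
    exact ⟨y, Or.inr ⟨y, hy, rfl⟩, g, congrArg Subtype.val hg⟩

end GSets

/-! ### Nominal sets over a data symmetry `(D, G)` -/

section Nominal

variable {D : Type u} (G : Subgroup (Equiv.Perm D))

/-- Every element has a finite support. -/
def IsNominal (X : Type*) [MulAction G X] : Prop :=
  ∀ z : X, ∃ C : Finset D, MulAction.Supports G (C : Set D) z

/-- `C` is the least finite support of `z`. -/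
def IsLeastSupport {X : Type*} [MulAction G X] (C : Finset D) (z : X) : Prop :=
  MulAction.Supports G (C : Set D) z ∧
    ∀ C' : Finset D, MulAction.Supports G (C' : Set D) z → C ⊆ C'

/-- Every element of every nominal `G`-set has a least (finite) support. Every one-orbit `G`-set is a
quotient of `G`, so it is enough to let `X` range over the universe of `D`. -/
def AdmitsLeastSupport : Prop :=
  ∀ (X : Type u) [MulAction G X], IsNominal G X → ∀ z : X, ∃ C : Finset D, IsLeastSupport G C z

end Nominal

/-! ### Data trees and contexts -/

/-- `m`-ary data trees over `A`: `node a k t` is the term `a(t₁, …, t_k)` with `k ≤ m`. -/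
inductive DTree (m : ℕ) (A : Type v) : Type v where
  | node (a : A) (k : Fin (m + 1)) (t : Fin k → DTree m A) : DTree m A

/-- Contexts: data trees over `A ∪ {x}` in which `x` labels exactly one node, which is a leaf.
`hole` is `x`; `node a k i b c` is the term with root `a`, with `k ≤ m` children, whose `i`-th child
is the context `c` and whose other children are the trees `b j`. -/
inductive Ctx (m : ℕ) (A : Type v) : Type v where
  | hole : Ctx m A
  | node (a : A) (k : Fin (m + 1)) (i : Fin k) (b : {j : Fin k // j ≠ i} → DTree m A)
      (c : Ctx m A) : Ctx m A

section Trees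

variable {m : ℕ} {A : Type v}

/-- The tree consisting of one node. -/
def DTree.leaf (a : A) : DTree m A := .node a 0 (fun i => i.elim0)

/-- `IsSubtree s t`: `s` is a subtree of `t`. -/
inductive IsSubtree : DTree m A → DTree m A → Prop where
  | refl (t : DTree m A) : IsSubtree t t
  | child (s : DTree m A) (a : A) (k : Fin (m + 1)) (t : Fin k → DTree m A) (i : Fin k) :
      IsSubtree s (t i) → IsSubtree s (.node a k t)

/-- `C[t]`, the tree obtained by replacing `x` in `C` by the tree `t`. -/
def Ctx.plug : Ctx m A → DTree m A → DTree m A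
  | .hole, s => s
  | .node a k i b c, s => .node a k fun j => if h : j = i then c.plug s else b ⟨j, h⟩

/-- `C[C']`, the context obtained by replacing `x` in `C` by the context `C'`. -/
def Ctx.comp : Ctx m A → Ctx m A → Ctx m A
  | .hole, c' => c'
  | .node a k i b c, c' => .node a k i b (c.comp c')

/-- `a(b₁, …, x, …, b_{k-1})` with `x` as `i`-th child. -/
def Ctx.elementary (a : A) (k : Fin (m + 1)) (i : Fin k)
    (b : {j : Fin k // j ≠ i} → DTree m A) : Ctx m A :=
  .node a k i b .hole

variable {Γ : Type*} [Group Γ] [MulAction Γ A]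

/-- The action on trees. -/
def DTree.act (g : Γ) : DTree m A → DTree m A
  | .node a k t => .node (g • a) k fun i => (t i).act g

instance : SMul Γ (DTree m A) := ⟨DTree.act⟩

@[simp] theorem smul_node (g : Γ) (a : A) (k : Fin (m + 1)) (t : Fin k → DTree m A) :
    g • DTree.node a k t = DTree.node (g • a) k fun i => g • t i := rfl

instance : MulAction Γ (DTree m A) where
  one_smul t := by
    induction t with
    | node a k t ih => simp [ih]
  mul_smul g h t := by
    induction t with
    | node a k t ih => simp [ih, mul_smul]

/-- The action on contexts, with `x` fixed. -/
def Ctx.act (g : Γ) : Ctx m A → Ctx m A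
  | .hole => .hole
  | .node a k i b c => .node (g • a) k i (fun j => g • b j) (c.act g)

instance : SMul Γ (Ctx m A) := ⟨Ctx.act⟩

@[simp] theorem smul_hole (g : Γ) : g • (Ctx.hole : Ctx m A) = Ctx.hole := rfl

@[simp] theorem smul_ctx_node (g : Γ) (a : A) (k : Fin (m + 1)) (i : Fin k)
    (b : {j : Fin k // j ≠ i} → DTree m A) (c : Ctx m A) :
    g • Ctx.node a k i b c = Ctx.node (g • a) k i (fun j => g • b j) (g • c) := rfl

instance : MulAction Γ (Ctx m A) where
  one_smul c := by
    induction c with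
    | hole => rfl
    | node a k i b c ih => simp [ih]
  mul_smul g h c := by
    induction c with
    | hole => rfl
    | node a k i b c ih => simp [ih, mul_smul]

theorem smul_leaf (g : Γ) (a : A) : g • (DTree.leaf a : DTree m A) = DTree.leaf (g • a) := by
  simp only [DTree.leaf, smul_node]
  congr 1
  funext i
  exact i.elim0

theorem smul_plug (g : Γ) (c : Ctx m A) (s : DTree m A) :
    g • c.plug s = (g • c).plug (g • s) := by
  induction c with
  | hole => rfl
  | node a k i b c ih =>
    simp only [Ctx.plug, smul_node, smul_ctx_node]
    congr 1
    funext j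
    split_ifs with h
    · exact ih
    · rfl

theorem smul_comp (g : Γ) (c c' : Ctx m A) : g • c.comp c' = (g • c).comp (g • c') := by
  induction c with
  | hole => rfl
  | node a k i b c ih => simp [Ctx.comp, ih]

theorem plug_comp (c c' : Ctx m A) (s : DTree m A) : (c.comp c').plug s = c.plug (c'.plug s) := by
  induction c with
  | hole => rfl
  | node a k i b c ih => simp [Ctx.comp, Ctx.plug, ih]

theorem isSubtree_smul {g : Γ} {s t : DTree m A} (h : IsSubtree s (g • t)) :
    ∃ s', IsSubtree s' t ∧ g • s' = s := by
  induction t with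
  | node a k t ih =>
    rw [smul_node] at h
    cases h with
    | refl => exact ⟨_, .refl _, rfl⟩
    | child _ _ _ i h =>
      obtain ⟨s', hs', rfl⟩ := ih i h
      exact ⟨s', .child _ _ _ _ i hs', rfl⟩

theorem IsSubtree.trans {r s t : DTree m A} (h₁ : IsSubtree r s) (h₂ : IsSubtree s t) :
    IsSubtree r t := by
  induction h₂ with
  | refl => exact h₁
  | child _ _ _ i _ ih => exact .child _ _ _ _ i ih

theorem finite_subtrees (t : DTree m A) : {s | IsSubtree s t}.Finite := by
  induction t with
  | node a k t ih =>
    refine ((Set.finite_iUnion ih).insert (DTree.node a k t)).subset ?_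
    intro s hs
    cases hs with
    | refl => exact Set.mem_insert _ _
    | child _ _ _ i h => exact Set.mem_insert_of_mem _ (Set.mem_iUnion.2 ⟨i, h⟩)

/-- Replacing equivalent children one at a time. -/
theorem rel_node_of_forall {β : Type*} (f : DTree m A → β) (S : Set (DTree m A))
    (H : ∀ s₁ ∈ S, ∀ s₂ ∈ S, f s₁ = f s₂ → ∀ (a : A) (k : Fin (m + 1)) (i : Fin k)
      (b : {j : Fin k // j ≠ i} → DTree m A), (∀ j, b j ∈ S) →
      f ((Ctx.elementary a k i b).plug s₁) = f ((Ctx.elementary a k i b).plug s₂))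
    (a : A) (k : Fin (m + 1)) (s s' : Fin k → DTree m A) (hs : ∀ i, s i ∈ S)
    (hs' : ∀ i, s' i ∈ S) (h : ∀ i, f (s i) = f (s' i)) :
    f (.node a k s) = f (.node a k s') := by
  classical
  have key : ∀ F : Finset (Fin k),
      f (.node a k s) = f (.node a k fun j => if j ∈ F then s' j else s j) := by
    intro F
    induction F using Finset.induction_on with
    | empty => simp
    | insert i F hi ih =>
      rw [ih]
      have hb : ∀ j : {j : Fin k // j ≠ i}, (if j.1 ∈ F then s' j.1 else s j.1) ∈ S := by
        intro j
        split_ifs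
        exacts [hs' _, hs _]
      have := H (s i) (hs i) (s' i) (hs' i) (h i) a k i
        (fun j => if j.1 ∈ F then s' j.1 else s j.1) hb
      simp only [Ctx.elementary, Ctx.plug] at this
      convert this using 3
      · funext j
        by_cases hj : j = i
        · subst hj; simp [hi]
        · simp [hj]
      · funext j
        by_cases hj : j = i
        · subst hj; simp
        · simp [hj]
  simpa using key Finset.univ

end Trees

/-! ### Deterministic bottom-up tree automata -/

/-- A deterministic bottom-up tree automaton (`G`-DBTA) over `m`-ary trees with state set `Q`. The
transition function `δ_k` is `trans · k ·`. -/
structure DBTA (Γ : Type*) [Group Γ] (m : ℕ) (A : Type*) [MulAction Γ A] (Q : Type*)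
    [MulAction Γ Q] where
  accept : SubMulAction Γ Q
  trans : A → (k : Fin (m + 1)) → (Fin k → Q) → Q
  trans_smul : ∀ (g : Γ) (a : A) (k : Fin (m + 1)) (q : Fin k → Q),
    trans (g • a) k (fun i => g • q i) = g • trans a k q

namespace DBTA

variable {Γ : Type*} [Group Γ] {m : ℕ} {A : Type*} [MulAction Γ A]
  {Q : Type*} [MulAction Γ Q] {Q' : Type*} [MulAction Γ Q']

/-- The extension of `δ` to trees. -/
def run (M : DBTA Γ m A Q) : DTree m A → Q
  | .node a k t => M.trans a k fun i => M.run (t i)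

theorem run_smul (M : DBTA Γ m A Q) (g : Γ) (t : DTree m A) : M.run (g • t) = g • M.run t := by
  induction t with
  | node a k t ih => simp only [smul_node, run, ih, M.trans_smul]

/-- `L(M)`, as an (automatically equivariant) set of trees. -/
def lang (M : DBTA Γ m A Q) : SubMulAction Γ (DTree m A) where
  carrier := {t | M.run t ∈ M.accept}
  smul_mem' g t ht := by
    change M.run (g • t) ∈ M.accept
    rw [run_smul]
    exact M.accept.smul_mem g ht

/-- `Below M' M` is `M' ⊑ M`: there is a surjective partial homomorphism from `M` to `M'`, defined
on an equivariant set `P` of states of `M`. -/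
def Below (M' : DBTA Γ m A Q') (M : DBTA Γ m A Q) : Prop :=
  ∃ (P : SubMulAction Γ Q) (φ : P →[Γ] Q'),
    (∀ q : P, (q : Q) ∈ M.accept ↔ φ q ∈ M'.accept) ∧
    (∀ (a : A) (k : Fin (m + 1)) (q : Fin k → P),
      ∃ h : M.trans a k (fun i => (q i : Q)) ∈ P,
        φ ⟨_, h⟩ = M'.trans a k (fun i => φ (q i))) ∧
    Function.Surjective φ

/-- Isomorphism of automata: a bijective homomorphism. -/
def Iso (M : DBTA Γ m A Q) (M' : DBTA Γ m A Q') : Prop :=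
  ∃ φ : Q →[Γ] Q', Function.Bijective φ ∧
    (∀ q : Q, q ∈ M.accept ↔ φ q ∈ M'.accept) ∧
    (∀ (a : A) (k : Fin (m + 1)) (q : Fin k → Q),
      φ (M.trans a k q) = M'.trans a k (fun i => φ (q i)))

end DBTA

/-- The automaton is nominal (a `G`-DBNTA): alphabet and state set are orbit finite and nominal. -/
def DBTA.IsDBNTA {D : Type*} {G : Subgroup (Equiv.Perm D)} {m : ℕ} {A : Type*} [MulAction G A]
    {Q : Type*} [MulAction G Q] (_ : DBTA G m A Q) : Prop :=
  (OrbitFinite G A ∧ IsNominal G A) ∧ (OrbitFinite G Q ∧ IsNominal G Q)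

/-- `U` is a recognizable nominal tree language. -/
def IsRecognizableNominal {D : Type*} {G : Subgroup (Equiv.Perm D)} {m : ℕ} {A : Type*}
    [MulAction G A] (U : SubMulAction G (DTree m A)) : Prop :=
  ∃ (Q : Type w) (_ : MulAction G Q) (M : DBTA G m A Q), M.IsDBNTA ∧ M.lang = U

/-! ### The syntactic tree automaton -/

section Syntactic

variable {Γ : Type*} [Group Γ] {m : ℕ} {A : Type v} [MulAction Γ A]

/-- `≈_U`. -/
def synSetoid (U : SubMulAction Γ (DTree m A)) : Setoid (DTree m A) where
  r s t := ∀ c : Ctx m A, c.plug s ∈ U ↔ c.plug t ∈ U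
  iseqv := ⟨fun _ _ => Iff.rfl, fun h c => (h c).symm, fun h₁ h₂ c => (h₁ c).trans (h₂ c)⟩

/-- `Q_U`, the set of classes of `≈_U`. -/
def SynState (U : SubMulAction Γ (DTree m A)) : Type v := Quotient (synSetoid U)

/-- The class `[t]`. -/
def SynState.mk (U : SubMulAction Γ (DTree m A)) (t : DTree m A) : SynState U :=
  Quotient.mk (synSetoid U) t

theorem SynState.mk_eq {U : SubMulAction Γ (DTree m A)} {s t : DTree m A} :
    SynState.mk U s = SynState.mk U t ↔ ∀ c : Ctx m A, c.plug s ∈ U ↔ c.plug t ∈ U :=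
  Quotient.eq (r := synSetoid U)

theorem SynState.exists_mk {U : SubMulAction Γ (DTree m A)} (q : SynState U) :
    ∃ t, SynState.mk U t = q := Quotient.exists_rep q

theorem plug_smul_mem {U : SubMulAction Γ (DTree m A)} (g : Γ) (c : Ctx m A) (s : DTree m A) :
    c.plug (g • s) ∈ U ↔ (g⁻¹ • c).plug s ∈ U := by
  rw [← SubMulAction.smul_mem_iff' U (g := g⁻¹), smul_plug, inv_smul_smul]

theorem smul_plug_mem {U : SubMulAction Γ (DTree m A)} (g : Γ) (c : Ctx m A) (s : DTree m A) :
    (g • c).plug (g • s) ∈ U ↔ c.plug s ∈ U := by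
  rw [← smul_plug, SubMulAction.smul_mem_iff']

instance (U : SubMulAction Γ (DTree m A)) : SMul Γ (SynState U) where
  smul g := Quotient.map (g • ·) (by
    intro s t h c
    rw [plug_smul_mem, plug_smul_mem]
    exact h _)

theorem SynState.smul_mk (U : SubMulAction Γ (DTree m A)) (g : Γ) (t : DTree m A) :
    g • SynState.mk U t = SynState.mk U (g • t) := rfl

instance (U : SubMulAction Γ (DTree m A)) : MulAction Γ (SynState U) where
  one_smul q := by
    obtain ⟨t, rfl⟩ := q.exists_mk
    rw [SynState.smul_mk, one_smul]
  mul_smul g h q := by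
    obtain ⟨t, rfl⟩ := q.exists_mk
    simp only [SynState.smul_mk, mul_smul]

/-- `≈_U` is a congruence. -/
theorem SynState.mk_node_congr (U : SubMulAction Γ (DTree m A)) (a : A) (k : Fin (m + 1))
    (s s' : Fin k → DTree m A) (h : ∀ i, SynState.mk U (s i) = SynState.mk U (s' i)) :
    SynState.mk U (.node a k s) = SynState.mk U (.node a k s') := by
  refine rel_node_of_forall (SynState.mk U) Set.univ ?_ a k s s' (fun _ => trivial)
    (fun _ => trivial) h
  intro s₁ _ s₂ _ h12 a k i b _
  rw [SynState.mk_eq] at h12 ⊢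
  intro c
  simpa only [plug_comp] using h12 (c.comp (Ctx.elementary a k i b))

/-- The syntactic tree automaton `A_U`: `F_U = {[t] | t ∈ U}` and
`δ_U(a, [t₁], …, [t_k]) = [a(t₁, …, t_k)]`. -/
noncomputable def synAutomaton (U : SubMulAction Γ (DTree m A)) : DBTA Γ m A (SynState U) where
  accept :=
    { carrier := {q | ∃ t ∈ U, q = SynState.mk U t}
      smul_mem' := by
        rintro g _ ⟨t, ht, rfl⟩
        exact ⟨g • t, U.smul_mem g ht, rfl⟩ }
  trans a k q := SynState.mk U (.node a k fun i => (q i).exists_mk.choose)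
  trans_smul g a k q := by
    rw [SynState.smul_mk, smul_node]
    refine SynState.mk_node_congr U _ _ _ _ fun i => ?_
    rw [(g • q i).exists_mk.choose_spec, ← SynState.smul_mk, (q i).exists_mk.choose_spec]

theorem synAutomaton_trans (U : SubMulAction Γ (DTree m A)) (a : A) (k : Fin (m + 1))
    (t : Fin k → DTree m A) :
    (synAutomaton U).trans a k (fun i => SynState.mk U (t i)) = SynState.mk U (.node a k t) :=
  SynState.mk_node_congr U _ _ _ _ fun i => (SynState.mk U (t i)).exists_mk.choose_spec

end Syntactic

/-! ### Observation tables -/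

section Tables

variable {Γ : Type*} [Group Γ] {m : ℕ} {A : Type v} [MulAction Γ A]

/-- `Next(S)`. -/
def next (S : Set (DTree m A)) : Set (DTree m A) :=
  {t | t ∉ S ∧ ∃ (a : A) (k : Fin (m + 1)) (s : Fin k → DTree m A),
    1 ≤ (k : ℕ) ∧ (∀ i, s i ∈ S) ∧ t = .node a k s}

/-- An observation table `(S, E, T)` for `U`. The requirements determine the entries
`T : E[S ∪ Next(S)] → {0, 1}` from `S` and `E`, so that `T` is a definition (`ObsTable.T`) and not a
field. A nonempty `E` contains `x` if it is `x`-prefix-closed; the nonemptiness is recorded in this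
form. -/
@[ext] structure ObsTable (U : SubMulAction Γ (DTree m A)) where
  S : SubMulAction Γ (DTree m A)
  E : SubMulAction Γ (Ctx m A)
  orbitFinite_S : OrbitFinite Γ S
  subtree_closed : ∀ t ∈ S, ∀ s, IsSubtree s t → s ∈ S
  leaf_mem : ∀ a : A, DTree.leaf a ∈ S
  orbitFinite_E : OrbitFinite Γ E
  hole_mem : Ctx.hole ∈ E
  prefix_closed : ∀ c ∈ E, c ≠ Ctx.hole → ∃ c' ∈ E, ∃ (a : A) (k : Fin (m + 1)) (i : Fin k)
    (b : {j : Fin k // j ≠ i} → DTree m A), (∀ j, b j ∈ S) ∧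
      c = c'.comp (Ctx.elementary a k i b)

namespace ObsTable

variable {U : SubMulAction Γ (DTree m A)}

/-- The set `S ∪ Next(S)` of row labels. -/
def rows (τ : ObsTable U) : Set (DTree m A) := (τ.S : Set (DTree m A)) ∪ next τ.S

/-- `E[S ∪ Next(S)]`. -/
def domain (τ : ObsTable U) : Set (DTree m A) :=
  {t | ∃ e ∈ τ.E, ∃ s ∈ τ.rows, t = e.plug s}

open Classical in
/-- The table entries (answers to membership queries). -/
noncomputable def T (τ : ObsTable U) (t : τ.domain) : Bool := decide ((t : DTree m A) ∈ U)

/-- `row(s)` for `s ∈ S ∪ Next(S)`. -/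
def row (τ : ObsTable U) (s : DTree m A) : Set (Ctx m A) :=
  {e | e ∈ τ.E ∧ ∃ h : e.plug s ∈ τ.domain, τ.T ⟨_, h⟩ = true}

theorem mem_row {τ : ObsTable U} {s : DTree m A} (hs : s ∈ τ.rows) {e : Ctx m A} :
    e ∈ τ.row s ↔ e ∈ τ.E ∧ e.plug s ∈ U := by
  constructor
  · rintro ⟨he, h, hT⟩
    exact ⟨he, by simpa [T] using hT⟩
  · rintro ⟨he, h⟩
    exact ⟨he, ⟨e, he, s, hs, rfl⟩, by simpa [T] using h⟩

theorem node_mem_rows (τ : ObsTable U) (a : A) (k : Fin (m + 1)) (s : Fin k → DTree m A)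
    (hs : ∀ i, s i ∈ τ.S) : DTree.node a k s ∈ τ.rows := by
  by_cases h : DTree.node a k s ∈ τ.S
  · exact Or.inl h
  · refine Or.inr ⟨h, a, k, s, ?_, hs, rfl⟩
    by_contra hk
    apply h
    have hk0 : k = 0 := Fin.ext (by simpa using hk)
    subst hk0
    have : s = fun i => i.elim0 := by funext i; exact i.elim0
    rw [this]
    exact τ.leaf_mem a

theorem smul_mem_rows (τ : ObsTable U) (g : Γ) {s : DTree m A} (hs : s ∈ τ.rows) :
    g • s ∈ τ.rows := by
  rcases hs with hs | ⟨-, a, k, s, -, hs, rfl⟩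
  · exact Or.inl (τ.S.smul_mem g hs)
  · rw [smul_node]
    exact τ.node_mem_rows _ _ _ fun i => τ.S.smul_mem g (hs i)

theorem row_smul (τ : ObsTable U) (g : Γ) {s : DTree m A} (hs : s ∈ τ.rows) :
    τ.row (g • s) = g • τ.row s := by
  ext e
  rw [Set.mem_smul_set_iff_inv_smul_mem, mem_row hs, mem_row (τ.smul_mem_rows g hs),
    plug_smul_mem, SubMulAction.smul_mem_iff']

/-- `row(S)` as a `Γ`-set. -/
def rowS (τ : ObsTable U) : SubMulAction Γ (Set (Ctx m A)) where
  carrier := τ.row '' τ.S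
  smul_mem' := by
    rintro g _ ⟨s, hs, rfl⟩
    exact ⟨g • s, τ.S.smul_mem g hs, τ.row_smul g (Or.inl hs)⟩

/-- Closed tables. -/
def Closed (τ : ObsTable U) : Prop :=
  ∀ t ∈ next (τ.S : Set (DTree m A)), ∃ s ∈ τ.S, τ.row t = τ.row s

/-- Consistent tables. -/
def Consistent (τ : ObsTable U) : Prop :=
  ∀ s₁ ∈ τ.S, ∀ s₂ ∈ τ.S, τ.row s₁ = τ.row s₂ → ∀ (a : A) (k : Fin (m + 1)) (i : Fin k)
    (b : {j : Fin k // j ≠ i} → DTree m A), (∀ j, b j ∈ τ.S) →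
    τ.row ((Ctx.elementary a k i b).plug s₁) = τ.row ((Ctx.elementary a k i b).plug s₂)

theorem row_mem_rowS {τ : ObsTable U} (hcl : τ.Closed) {t : DTree m A} (ht : t ∈ τ.rows) :
    τ.row t ∈ τ.rowS := by
  rcases ht with ht | ht
  · exact ⟨t, ht, rfl⟩
  · obtain ⟨s, hs, h⟩ := hcl t ht
    exact ⟨s, hs, h.symm⟩

theorem exists_rep (τ : ObsTable U) (q : τ.rowS) : ∃ s, s ∈ τ.S ∧ τ.row s = q := q.2

/-- The automaton derived from a closed and consistent table: states `row(S)`, accepting states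
`row(s)` with `s ∈ S` and `T(s) = 1`, and
`δ(a, row(s₁), …, row(s_k)) = row(a(s₁, …, s_k))` for `s₁, …, s_k ∈ S`. -/
noncomputable def automaton (τ : ObsTable U) (hcl : τ.Closed) (hco : τ.Consistent) :
    DBTA Γ m A τ.rowS where
  accept :=
    { carrier := {q | ∃ s ∈ τ.S, (∃ h : s ∈ τ.domain, τ.T ⟨s, h⟩ = true) ∧
        (q : Set (Ctx m A)) = τ.row s}
      smul_mem' := by
        rintro g ⟨_, hq⟩ ⟨s, hs, ⟨h, hT⟩, rfl⟩
        refine ⟨g • s, τ.S.smul_mem g hs, ⟨⟨Ctx.hole, τ.hole_mem, g • s,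
          Or.inl (τ.S.smul_mem g hs), rfl⟩, ?_⟩, (τ.row_smul g (Or.inl hs)).symm⟩
        simp only [T, decide_eq_true_eq] at hT ⊢
        exact U.smul_mem g hT }
  trans a k q := ⟨τ.row (.node a k fun i => (τ.exists_rep (q i)).choose),
    row_mem_rowS hcl (τ.node_mem_rows _ _ _ fun i => (τ.exists_rep (q i)).choose_spec.1)⟩
  trans_smul g a k q := by
    ext1
    change τ.row _ = g • τ.row _
    rw [← τ.row_smul g (τ.node_mem_rows _ _ _ fun i => (τ.exists_rep (q i)).choose_spec.1),
      smul_node]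
    refine rel_node_of_forall τ.row τ.S hco _ _ _ _
      (fun i => (τ.exists_rep (g • q i)).choose_spec.1)
      (fun i => τ.S.smul_mem g (τ.exists_rep (q i)).choose_spec.1) fun i => ?_
    rw [(τ.exists_rep (g • q i)).choose_spec.2,
      τ.row_smul g (Or.inl (τ.exists_rep (q i)).choose_spec.1),
      (τ.exists_rep (q i)).choose_spec.2]
    rfl

theorem automaton_trans (τ : ObsTable U) (hcl : τ.Closed) (hco : τ.Consistent) (a : A)
    (k : Fin (m + 1)) (s : Fin k → DTree m A) (hs : ∀ i, s i ∈ τ.S) :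
    ((τ.automaton hcl hco).trans a k fun i => ⟨τ.row (s i), s i, hs i, rfl⟩ : Set (Ctx m A)) =
      τ.row (.node a k s) :=
  rel_node_of_forall τ.row τ.S hco _ _ _ _ (fun _ => (τ.exists_rep _).choose_spec.1) hs
    fun i => (τ.exists_rep ⟨τ.row (s i), s i, hs i, rfl⟩).choose_spec.2

/-! #### The tables that the algorithm builds -/

/-- The initial table: `S = A`, `E = {x}`. -/
def initial (U : SubMulAction Γ (DTree m A)) (hA : OrbitFinite Γ A) : ObsTable U where
  S :=
    { carrier := Set.range DTree.leaf
      smul_mem' := by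
        rintro g _ ⟨a, rfl⟩
        exact ⟨g • a, (smul_leaf g a).symm⟩ }
  E :=
    { carrier := {Ctx.hole}
      smul_mem' := by
        rintro g _ rfl
        rfl }
  orbitFinite_S := by
    obtain ⟨F, hF, h⟩ := exists_cover_of_orbitFinite hA
    refine orbitFinite_of_cover (hF.image DTree.leaf) ?_
    rintro _ ⟨a, rfl⟩
    obtain ⟨y, hy, g, rfl⟩ := h a
    exact ⟨_, ⟨y, hy, rfl⟩, g, smul_leaf g y⟩
  subtree_closed := by
    rintro _ ⟨a, rfl⟩ s hs
    cases hs with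
    | refl => exact ⟨a, rfl⟩
    | child _ _ _ i _ => exact i.elim0
  leaf_mem a := ⟨a, rfl⟩
  orbitFinite_E := orbitFinite_of_cover (Set.finite_singleton Ctx.hole) (by
    rintro _ rfl
    exact ⟨_, rfl, 1, rfl⟩)
  hole_mem := rfl
  prefix_closed c hc hne := absurd hc hne

/-- Add `Orbit(e[a(b₁, …, x, …, b_{k-1})])` to `E`. -/
def addContext (τ : ObsTable U) (e : Ctx m A) (he : e ∈ τ.E) (a : A) (k : Fin (m + 1)) (i : Fin k)
    (b : {j : Fin k // j ≠ i} → DTree m A) (hb : ∀ j, b j ∈ τ.S) : ObsTable U where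
  S := τ.S
  E := τ.E ⊔ orbitSpan Γ {e.comp (Ctx.elementary a k i b)}
  orbitFinite_S := τ.orbitFinite_S
  subtree_closed := τ.subtree_closed
  leaf_mem := τ.leaf_mem
  orbitFinite_E := orbitFinite_sup τ.orbitFinite_E (orbitFinite_orbitSpan (Set.finite_singleton _))
  hole_mem := Or.inl τ.hole_mem
  prefix_closed c hc hne := by
    rcases mem_sup_iff.1 hc with hc | ⟨_, rfl, g, rfl⟩
    · obtain ⟨c', hc', h⟩ := τ.prefix_closed c hc hne
      exact ⟨c', Or.inl hc', h⟩
    · exact ⟨g • e, Or.inl (τ.E.smul_mem g he), g • a, k, i, fun j => g • b j,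
        fun j => τ.S.smul_mem g (hb j), smul_comp g e _⟩

/-- Add `Orbit(F)` to `S`, for a finite set `F` of trees whose subtrees lie in `S ∪ F`. -/
def addTrees (τ : ObsTable U) (F : Set (DTree m A)) (hF : F.Finite)
    (hsub : ∀ t ∈ F, ∀ s, IsSubtree s t → s ∈ τ.S ∨ s ∈ F) : ObsTable U where
  S := τ.S ⊔ orbitSpan Γ F
  E := τ.E
  orbitFinite_S := orbitFinite_sup τ.orbitFinite_S (orbitFinite_orbitSpan hF)
  subtree_closed := by
    intro t ht s hs
    rcases mem_sup_iff.1 ht with ht | ⟨y, hy, g, rfl⟩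
    · exact Or.inl (τ.subtree_closed t ht s hs)
    · obtain ⟨s', hs', rfl⟩ := isSubtree_smul hs
      rcases hsub y hy s' hs' with h | h
      · exact Or.inl (τ.S.smul_mem g h)
      · exact Or.inr ⟨s', h, g, rfl⟩
  leaf_mem a := Or.inl (τ.leaf_mem a)
  orbitFinite_E := τ.orbitFinite_E
  hole_mem := τ.hole_mem
  prefix_closed c hc hne := by
    obtain ⟨c', hc', a, k, i, b, hb, h⟩ := τ.prefix_closed c hc hne
    exact ⟨c', hc', a, k, i, b, fun j => Or.inl (hb j), h⟩

/-- Add `Orbit(s')` to `S`, for `s' ∈ Next(S)`. -/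
def addRow (τ : ObsTable U) (s' : DTree m A) (h : s' ∈ next (τ.S : Set (DTree m A))) :
    ObsTable U :=
  τ.addTrees {s'} (Set.finite_singleton s') (by
    rintro _ rfl s hs
    obtain ⟨-, a, k, t, -, ht, rfl⟩ := h
    cases hs with
    | refl => exact Or.inr rfl
    | child _ _ _ i hs => exact Or.inl (τ.subtree_closed _ (ht i) _ hs))

/-- Add `Orbit(Subtree(t))` to `S`. -/
def addSubtrees (τ : ObsTable U) (t : DTree m A) : ObsTable U :=
  τ.addTrees {s | IsSubtree s t} (finite_subtrees t) fun _ hy _ hs => Or.inr (hs.trans hy)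

/-- One extension of an inconsistent table: some `s₁, s₂, b₁, …, b_{k-1} ∈ S`, `e ∈ E`, `a`, `i` with
`row(s₁) = row(s₂)` and `T(e[a(b₁, …, s₁, …, b_{k-1})]) ≠ T(e[a(b₁, …, s₂, …, b_{k-1})])` are chosen,
and `Orbit(e[a(b₁, …, x, …, b_{k-1})])` is added to `E`. -/
inductive ConsistencyExt : ObsTable U → ObsTable U → Prop where
  | intro (τ : ObsTable U) (s₁ s₂ : DTree m A) (hs₁ : s₁ ∈ τ.S) (hs₂ : s₂ ∈ τ.S)
      (hrow : τ.row s₁ = τ.row s₂) (e : Ctx m A) (he : e ∈ τ.E) (a : A) (k : Fin (m + 1))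
      (i : Fin k) (b : {j : Fin k // j ≠ i} → DTree m A) (hb : ∀ j, b j ∈ τ.S)
      (hne : ¬ (e ∈ τ.row ((Ctx.elementary a k i b).plug s₁) ↔
        e ∈ τ.row ((Ctx.elementary a k i b).plug s₂))) :
      ConsistencyExt τ (τ.addContext e he a k i b hb)

/-- One extension of a table that is not closed: some `s' ∈ Next(S)` with `row(s') ≠ row(s)` for all
`s ∈ S` is chosen, and `Orbit(s')` is added to `S`. -/
inductive ClosednessExt : ObsTable U → ObsTable U → Prop where
  | intro (τ : ObsTable U) (s' : DTree m A) (hs' : s' ∈ next (τ.S : Set (DTree m A)))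
      (hrow : ∀ s ∈ τ.S, τ.row s' ≠ τ.row s) : ClosednessExt τ (τ.addRow s' hs')

/-- The extension of a closed and consistent table after the teacher rejects the conjecture with any
counterexample `t` (a tree on which `U` and the language of the conjecture differ):
`Orbit(Subtree(t))` is added to `S`. -/
inductive CounterexampleExt : ObsTable U → ObsTable U → Prop where
  | intro (τ : ObsTable U) (hcl : τ.Closed) (hco : τ.Consistent) (t : DTree m A)
      (ht : ¬ (t ∈ U ↔ t ∈ (τ.automaton hcl hco).lang)) :
      CounterexampleExt τ (τ.addSubtrees t)

end ObsTable

/-! ### The learning algorithm -/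

/-- Configurations of the algorithm: the program point together with the current table.
* `loop`: head of the while loop;
* `closedTest`: in the body of the while loop, before the test for closedness;
* `conjecture`: the while loop is left, the table is closed and consistent, and its automaton is
  submitted in an equivalence query;
* `halted`: the teacher has answered yes, and the automaton of the table is returned. -/
inductive Config (U : SubMulAction Γ (DTree m A)) where
  | loop (τ : ObsTable U)
  | closedTest (τ : ObsTable U)
  | conjecture (τ : ObsTable U) (hcl : τ.Closed) (hco : τ.Consistent)
  | halted (τ : ObsTable U) (hcl : τ.Closed) (hco : τ.Consistent)

/-- The steps of the algorithm. All choices (of the witnesses by the learner, of the counterexamples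
by the teacher) are nondeterministic. The teacher answers yes if and only if the conjecture
recognizes `U`. -/
inductive Step {U : SubMulAction Γ (DTree m A)} : Config U → Config U → Prop where
  | exitLoop (τ : ObsTable U) (hcl : τ.Closed) (hco : τ.Consistent) :
      Step (.loop τ) (.conjecture τ hcl hco)
  | fixConsistency (τ τ' : ObsTable U) (hco : ¬ τ.Consistent) (h : τ.ConsistencyExt τ') :
      Step (.loop τ) (.closedTest τ')
  | skipConsistency (τ : ObsTable U) (hco : τ.Consistent) (hcl : ¬ τ.Closed) :
      Step (.loop τ) (.closedTest τ)
  | fixClosedness (τ τ' : ObsTable U) (hcl : ¬ τ.Closed) (h : τ.ClosednessExt τ') :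
      Step (.closedTest τ) (.loop τ')
  | skipClosedness (τ : ObsTable U) (hcl : τ.Closed) :
      Step (.closedTest τ) (.loop τ)
  | rejected (τ τ' : ObsTable U) (hcl : τ.Closed) (hco : τ.Consistent)
      (h : τ.CounterexampleExt τ') : Step (.conjecture τ hcl hco) (.loop τ')
  | accepted (τ : ObsTable U) (hcl : τ.Closed) (hco : τ.Consistent)
      (h : (τ.automaton hcl hco).lang = U) :
      Step (.conjecture τ hcl hco) (.halted τ hcl hco)

/-- The configuration after the initialization. -/
def Config.start (U : SubMulAction Γ (DTree m A)) (hA : OrbitFinite Γ A) : Config U :=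
  .loop (.initial U hA)

/-- The algorithm can reach the configuration `c`. -/
def Config.Reachable (U : SubMulAction Γ (DTree m A)) (hA : OrbitFinite Γ A) (c : Config U) :
    Prop :=
  Relation.ReflTransGen Step (Config.start U hA) c

end Tables

end NominalTree

open NominalTree

namespace NominalTree

/-! ### A rank for orbit finite sets, monotone under partial equivariant surjections. -/

section OrbitRank

variable {Γ : Type*} [Group Γ]

/-! Everything is measured by one natural number, `orbitRank`: each orbit of a set contributes the
number of subgroups above the stabilizer of one of its points. A partial equivariant surjection can
drop orbits, merge orbits and enlarge stabilizers, and each of these lowers the rank as soon as the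
summands are finite. Hence the rank is monotone for `≼`, strictly so for `≺`
(`orbitRank_le_of_surjective`, `NomLT.orbitRank_lt`), which bounds the chains. The finiteness is
where least supports enter (`IsNominal.finite_Ici_stabilizer`): a subgroup above a stabilizer is
determined by its least support, a subset of a fixed finite set, and by how it permutes that
support.

For the algorithm, `row(s)` depends only on the class of `s` modulo `≈_U`, so `row(S) ≼ Q_U` and all
ranks are bounded by that of `Q_U`. A larger table has longer rows on more labels; restricting the
rows gives `row(S) ≼ row(S')`. The comparison is strict when the old labels miss a new row
(closedness) or two equal rows become different (consistency). After a counterexample `t`, if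
neither happened, the old and the new automaton would accept the same trees (`automaton_lang_eq`);
but a conjecture is right on the labels of its own table, and `t` is now one of them. Steps that
keep the rank are counted by `Config.weight`, so no run is infinite.

Finally, a conjecture recognizing `U` reaches every state on some label, and equality of states is
exactly `≈_U` (`automaton_run_eq_iff`); this makes it minimal and isomorphic to `A_U`. -/

theorem NomLE.orbitFinite {Y X : Type*} [MulAction Γ Y] [MulAction Γ X] (h : NomLE Γ Y X)
    (hX : OrbitFinite Γ X) : OrbitFinite Γ Y := by
  classical
  obtain ⟨P, f, hf⟩ := h
  obtain ⟨F, hF, hFX⟩ := exists_cover_of_orbitFinite hX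
  have : Finite (MulAction.orbitRel.Quotient Γ X) := hX
  choose s hs using hf
  -- The orbits of `Y` inject into those of `X`: an element of `Γ` moving one chosen preimage to
  -- another also moves their images.
  refine Finite.of_injective
    (fun o : MulAction.orbitRel.Quotient Γ Y =>
      (Quotient.mk _ (s o.out : X) : MulAction.orbitRel.Quotient Γ X)) ?_
  intro o o' h
  obtain ⟨g, hg⟩ := Quotient.exact h
  have hg' : g • s o'.out = s o.out := Subtype.ext hg
  rw [← Quotient.out_eq o, ← Quotient.out_eq o']
  refine Quotient.sound ⟨g, ?_⟩
  change g • o'.out = o.out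
  rw [← hs o'.out, ← map_smul, hg', hs]

/-- Sum over the orbits of the numbers of subgroups containing a stabilizer. -/
noncomputable def orbitRank (Γ : Type*) [Group Γ] (X : Type*) [MulAction Γ X] : ℕ :=
  ∑ᶠ q : MulAction.orbitRel.Quotient Γ X, (Set.Ici (MulAction.stabilizer Γ q.out)).ncard

/-- Conjugation is an order automorphism of the subgroup lattice carrying one stabilizer to the
other. So the summands of `orbitRank` do not depend on the representative `Quotient.out`. -/
theorem ncard_Ici_stabilizer_smul {X : Type*} [MulAction Γ X] (g : Γ) (z : X) :
    (Set.Ici (MulAction.stabilizer Γ (g • z))).ncard =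
      (Set.Ici (MulAction.stabilizer Γ z)).ncard := by
  have h : Set.Ici (MulAction.stabilizer Γ (g • z)) =
      (MulAut.conj g).mapSubgroup '' Set.Ici (MulAction.stabilizer Γ z) := by
    rw [OrderIso.image_Ici, MulAction.stabilizer_smul_eq_stabilizer_map_conj]
    rfl
  rw [h, Set.ncard_image_of_injective _ (OrderIso.injective _)]

/-- Orbits of `Y` are matched with distinct orbits of `X` through preimages of representatives,
whose stabilizers can only be smaller and so have at least as many overgroups. Equality of ranks
leaves no orbit unmatched and no stabilizer enlarged. Finiteness matters because `Set.ncard` is 0 on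
infinite sets. -/
theorem orbitRank_le_of_surjective {Y X : Type*} [MulAction Γ Y] [MulAction Γ X]
    (hX : OrbitFinite Γ X) (hfin : ∀ z : X, (Set.Ici (MulAction.stabilizer Γ z)).Finite)
    {P : SubMulAction Γ X} (f : P →[Γ] Y) (hf : Function.Surjective f) :
    orbitRank Γ Y ≤ orbitRank Γ X ∧
      (orbitRank Γ X ≤ orbitRank Γ Y → (∀ z, z ∈ P) ∧ Function.Injective f) := by
  classical
  have hY : OrbitFinite Γ Y := NomLE.orbitFinite ⟨P, f, hf⟩ hX
  let _ : Fintype (MulAction.orbitRel.Quotient Γ X) := @Fintype.ofFinite _ hX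
  let _ : Fintype (MulAction.orbitRel.Quotient Γ Y) := @Fintype.ofFinite _ hY
  choose s hs using hf
  set j : MulAction.orbitRel.Quotient Γ Y → MulAction.orbitRel.Quotient Γ X :=
    fun o => Quotient.mk _ (s o.out : X) with hj
  have hjinj : Function.Injective j := by
    intro o o' h
    obtain ⟨g, hg⟩ := Quotient.exact h
    have hg' : g • s o'.out = s o.out := Subtype.ext hg
    rw [← Quotient.out_eq o, ← Quotient.out_eq o']
    refine Quotient.sound ⟨g, ?_⟩
    change g • o'.out = o.out
    rw [← hs o'.out, ← map_smul, hg', hs]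
  have hstab (o : MulAction.orbitRel.Quotient Γ Y) :
      MulAction.stabilizer Γ (s o.out : X) ≤ MulAction.stabilizer Γ o.out := by
    intro g hg
    have hg' : g • s o.out = s o.out := Subtype.ext hg
    change g • o.out = o.out
    conv_lhs => rw [← hs o.out, ← map_smul, hg', hs]
  have hcard (o : MulAction.orbitRel.Quotient Γ Y) :
      (Set.Ici (MulAction.stabilizer Γ (j o).out)).ncard =
        (Set.Ici (MulAction.stabilizer Γ (s o.out : X))).ncard := by
    obtain ⟨g, hg⟩ : (MulAction.orbitRel Γ X) (j o).out (s o.out : X) := Quotient.mk_out _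
    rw [← hg]
    exact ncard_Ici_stabilizer_smul g _
  have hle (o : MulAction.orbitRel.Quotient Γ Y) :
      (Set.Ici (MulAction.stabilizer Γ o.out)).ncard ≤
        (Set.Ici (MulAction.stabilizer Γ (j o).out)).ncard := by
    rw [hcard]
    exact Set.ncard_le_ncard (Set.Ici_subset_Ici.2 (hstab o)) (hfin _)
  have h1 : orbitRank Γ Y ≤ ∑ o, (Set.Ici (MulAction.stabilizer Γ (j o).out)).ncard := by
    rw [orbitRank, finsum_eq_sum_of_fintype]
    exact Finset.sum_le_sum fun o _ => hle o
  have h2 : ∑ o, (Set.Ici (MulAction.stabilizer Γ (j o).out)).ncard ≤ orbitRank Γ X := by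
    rw [orbitRank, finsum_eq_sum_of_fintype, ← Finset.sum_image (s := Finset.univ) (g := j)
      (f := fun q => (Set.Ici (MulAction.stabilizer Γ q.out)).ncard) hjinj.injOn]
    exact Finset.sum_le_sum_of_subset (Finset.subset_univ _)
  refine ⟨h1.trans h2, fun h => ?_⟩
  have hjsurj : Function.Surjective j := by
    intro q
    by_contra hq
    push Not at hq
    -- An unmatched orbit would contribute at least 1, since a stabilizer lies above itself.
    have : ∑ o, (Set.Ici (MulAction.stabilizer Γ (j o).out)).ncard < orbitRank Γ X := by
      rw [orbitRank, finsum_eq_sum_of_fintype, ← Finset.sum_image (s := Finset.univ) (g := j)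
        (f := fun q => (Set.Ici (MulAction.stabilizer Γ q.out)).ncard) hjinj.injOn]
      refine Finset.sum_lt_sum_of_subset (Finset.subset_univ _) (Finset.mem_univ q) ?_ ?_ ?_
      · simpa using hq
      · exact (Set.ncard_pos (hfin _)).2 Set.nonempty_Ici
      · exact fun _ _ _ => Nat.zero_le _
    omega
  have heq (o : MulAction.orbitRel.Quotient Γ Y) :
      MulAction.stabilizer Γ o.out = MulAction.stabilizer Γ (s o.out : X) := by
    have h3 : ∑ o : MulAction.orbitRel.Quotient Γ Y,
        (Set.Ici (MulAction.stabilizer Γ o.out)).ncard =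
        ∑ o, (Set.Ici (MulAction.stabilizer Γ (j o).out)).ncard := by
      rw [orbitRank, orbitRank, finsum_eq_sum_of_fintype, finsum_eq_sum_of_fintype] at h
      rw [orbitRank, finsum_eq_sum_of_fintype] at h1 h2
      omega
    -- Equal sums of termwise comparable summands agree termwise; nested finite up-sets of equal
    -- size coincide, and so do their least elements.
    have h4 := (Finset.sum_eq_sum_iff_of_le fun o _ => hle o).1 h3 o (Finset.mem_univ o)
    rw [hcard] at h4
    exact Set.Ici_injective
      (Set.eq_of_subset_of_ncard_le (Set.Ici_subset_Ici.2 (hstab o)) h4.ge (hfin _))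
  have hrep (z : X) : ∃ (o : MulAction.orbitRel.Quotient Γ Y) (g : Γ), g • (s o.out : X) = z := by
    obtain ⟨o, ho⟩ := hjsurj (Quotient.mk _ z)
    obtain ⟨g, hg⟩ := Quotient.exact ho.symm
    exact ⟨o, g, hg⟩
  refine ⟨fun z => ?_, fun z z' hzz' => ?_⟩
  · obtain ⟨o, g, rfl⟩ := hrep z
    exact P.smul_mem g (s o.out).2
  · obtain ⟨o, g, hg⟩ := hrep z
    obtain ⟨o', g', hg'⟩ := hrep z'
    obtain rfl : g • s o.out = z := Subtype.ext hg
    obtain rfl : g' • s o'.out = z' := Subtype.ext hg'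
    rw [map_smul, map_smul, hs, hs] at hzz'
    obtain rfl : o = o' := by
      rw [← Quotient.out_eq o, ← Quotient.out_eq o']
      refine Quotient.sound ⟨g⁻¹ * g', ?_⟩
      change (g⁻¹ * g') • o'.out = o.out
      rw [mul_smul, ← hzz', inv_smul_smul]
    -- Within one orbit, injectivity of `f` is the equality of stabilizers `heq`.
    have : g'⁻¹ * g ∈ MulAction.stabilizer Γ o.out := by
      rw [MulAction.mem_stabilizer_iff, mul_smul, hzz', inv_smul_smul]
    rw [heq, MulAction.mem_stabilizer_iff, mul_smul, inv_smul_eq_iff] at this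
    exact Subtype.ext this

/-- An equivariant map that factors through another one induces a partial map. -/
theorem exists_partialMap_of_factor {T X Y : Type*} [MulAction Γ T] [MulAction Γ X]
    [MulAction Γ Y] (f : T →[Γ] X) (g : T →[Γ] Y) (h : ∀ s t, f s = f t → g s = g t) :
    ∃ (P : SubMulAction Γ X) (φ : P →[Γ] Y), (∀ z, z ∈ P ↔ ∃ t, f t = z) ∧
      ∀ t (ht : f t ∈ P), φ ⟨f t, ht⟩ = g t := by
  let P : SubMulAction Γ X :=
    { carrier := Set.range f
      smul_mem' := by
        rintro c _ ⟨t, rfl⟩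
        exact ⟨c • t, map_smul f c t⟩ }
  -- The induced map applies `g` to a chosen preimage under `f`; `h` makes the choice irrelevant.
  have hφ (t : T) (ht : f t ∈ P) : g (Exists.choose (id ht : ∃ t', f t' = f t)) = g t :=
    h _ _ (Exists.choose_spec (id ht : ∃ t', f t' = f t))
  refine ⟨P, ⟨fun z => g z.2.choose, ?_⟩, fun _ => Iff.rfl, hφ⟩
  rintro c ⟨_, t, rfl⟩
  have h1 : c • (⟨f t, t, rfl⟩ : P) = ⟨f (c • t), c • t, rfl⟩ := Subtype.ext (map_smul f c t).symm
  rw [h1]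
  exact (hφ _ ⟨c • t, rfl⟩).trans
    ((map_smul g c t).trans (congrArg (c • ·) (hφ t ⟨t, rfl⟩).symm))

theorem nomLE_of_factor {T X Y : Type*} [MulAction Γ T] [MulAction Γ X]
    [MulAction Γ Y] (f : T →[Γ] X) (g : T →[Γ] Y) (hg : Function.Surjective g)
    (h : ∀ s t, f s = f t → g s = g t) : NomLE Γ Y X := by
  obtain ⟨P, φ, hP, hφ⟩ := exists_partialMap_of_factor f g h
  refine ⟨P, φ, fun y => ?_⟩
  obtain ⟨t, rfl⟩ := hg y
  exact ⟨⟨f t, (hP _).2 ⟨t, rfl⟩⟩, hφ _ _⟩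

theorem nomLE_of_surjective {X Y : Type*} [MulAction Γ X] [MulAction Γ Y] (f : X →[Γ] Y)
    (hf : Function.Surjective f) : NomLE Γ Y X :=
  nomLE_of_factor (MulActionHom.id Γ) f hf fun _ _ h => congrArg f h

end OrbitRank

/-! ### Least supports, finiteness of the rank, and strict comparison. -/

section Nominal

variable {D : Type u} {G : Subgroup (Equiv.Perm D)}

theorem NomLE.isNominal {Y X : Type*} [MulAction G Y] [MulAction G X] (h : NomLE G Y X)
    (hX : IsNominal G X) : IsNominal G Y := by
  obtain ⟨P, f, hf⟩ := h
  intro y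
  obtain ⟨z, rfl⟩ := hf y
  obtain ⟨C, hC⟩ := hX z
  refine ⟨C, fun g hg => ?_⟩
  rw [← map_smul]
  exact congrArg f (Subtype.ext (hC g hg))

/-- The supports of the trivial coset in `G ⧸ K` are the sets whose pointwise fixer lies in `K`, so
this is the hypothesis on least supports applied to that coset space, which lives in the universe of
`D`. -/
theorem exists_least_support_subgroup (hG : AdmitsLeastSupport G) (K : Subgroup G) (C : Finset D)
    (hC : ∀ g : G, (∀ d ∈ C, g • d = d) → g ∈ K) :
    ∃ C₀ : Finset D, (∀ g : G, (∀ d ∈ C₀, g • d = d) → g ∈ K) ∧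
      ∀ C' : Finset D, (∀ g : G, (∀ d ∈ C', g • d = d) → g ∈ K) → C₀ ⊆ C' := by
  classical
  have key (C : Finset D) : MulAction.Supports G (C : Set D) ((1 : G) : G ⧸ K) ↔
      ∀ g : G, (∀ d ∈ C, g • d = d) → g ∈ K := by
    refine forall_congr' fun g => imp_congr (by simp) ?_
    rw [MulAction.Quotient.smul_coe, smul_eq_mul, mul_one, eq_comm, QuotientGroup.eq]
    simp
  have hnom : IsNominal G (G ⧸ K) := by
    intro q
    obtain ⟨h, rfl⟩ := QuotientGroup.mk_surjective q
    -- The coset of `h` is supported by the translate of `C` by `h`.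
    refine ⟨C.image fun d => h • d, fun g hg => ?_⟩
    rw [MulAction.Quotient.smul_coe, smul_eq_mul, eq_comm, QuotientGroup.eq]
    refine hC _ fun d hd => ?_
    rw [mul_smul, mul_smul, hg (a := h • d) (by
      rw [Finset.mem_coe]; exact Finset.mem_image_of_mem _ hd), inv_smul_smul]
  obtain ⟨C₀, h1, h2⟩ := hG (G ⧸ K) hnom ((1 : G) : G ⧸ K)
  exact ⟨C₀, (key C₀).1 h1, fun C' hC' => h2 C' ((key C').2 hC')⟩

/-- Only finitely many subgroups contain the stabilizer of a finitely supported element. -/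
theorem IsNominal.finite_Ici_stabilizer {X : Type*} [MulAction G X] (hX : IsNominal G X)
    (hG : AdmitsLeastSupport G) (z : X) : (Set.Ici (MulAction.stabilizer G z)).Finite := by
  classical
  obtain ⟨C, hC⟩ := hX z
  have hex (K : Subgroup G) : ∃ C₀ : Finset D, MulAction.stabilizer G z ≤ K →
      (∀ g : G, (∀ d ∈ C₀, g • d = d) → g ∈ K) ∧
      ∀ C' : Finset D, (∀ g : G, (∀ d ∈ C', g • d = d) → g ∈ K) → C₀ ⊆ C' := by
    by_cases h : MulAction.stabilizer G z ≤ K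
    · obtain ⟨C₀, h₀⟩ := exists_least_support_subgroup hG K C
        fun g hg => h (hC g fun d hd => hg _ hd)
      exact ⟨C₀, fun _ => h₀⟩
    -- A junk value, so that `S` can be chosen for all subgroups at once.
    · exact ⟨∅, fun h' => absurd h' h⟩
  choose S hS using hex
  have hSC {K : Subgroup G} (hK : MulAction.stabilizer G z ≤ K) : S K ⊆ C :=
    (hS K hK).2 C fun g hg => hK (hC g fun d hd => hg _ hd)
  have hmem {K : Subgroup G} (hK : MulAction.stabilizer G z ≤ K) {g : G} (hg : g ∈ K) {d : D}
      (hd : d ∈ S K) : g • d ∈ S K := by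
    -- For `g ∈ K` the translate of `S K` by `g⁻¹` also supports `K`, by conjugation with `g`;
    -- minimality then makes `S K` stable under `K`.
    have := (hS K hK).2 ((S K).image fun d => g⁻¹ • d) (fun h hh => by
      have h1 : g * h * g⁻¹ ∈ K := (hS K hK).1 _ fun d hd => by
        have := hh (g⁻¹ • d) (Finset.mem_image_of_mem _ hd)
        rw [mul_smul, mul_smul, this, smul_inv_smul]
      simpa [mul_assoc] using K.mul_mem (K.mul_mem (K.inv_mem hg) h1) hg) hd
    obtain ⟨d', hd', rfl⟩ := Finset.mem_image.1 this
    rwa [smul_inv_smul]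
  -- The restrictions of the elements of `K` to `S K`, encoded as subsets of `C × C`, so that only
  -- finitely many pairs `(S K, graphs K)` occur.
  let graphs (K : Subgroup G) : Set (Set (D × D)) :=
    {R | ∃ g ∈ K, R = {p | p.1 ∈ S K ∧ g • p.1 = p.2}}
  refine Set.Finite.of_finite_image (f := fun K => (S K, graphs K)) ?_ ?_
  · refine Set.Finite.subset (Set.Finite.prod (C.powerset.finite_toSet)
      (((C.finite_toSet.prod C.finite_toSet).powerset).powerset)) ?_
    rintro _ ⟨K, hK, rfl⟩
    refine ⟨by simpa using hSC hK, ?_⟩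
    rintro _ ⟨g, hg, rfl⟩ ⟨d, d'⟩ ⟨h1, h2⟩
    simp only at h1 h2
    subst h2
    exact ⟨hSC hK h1, hSC hK (hmem hK hg h1)⟩
  · have hle {K K' : Subgroup G} (hK' : MulAction.stabilizer G z ≤ K') (h1 : S K = S K')
        (h2 : graphs K = graphs K') : K ≤ K' := by
      intro g hg
      have : {p : D × D | p.1 ∈ S K ∧ g • p.1 = p.2} ∈ graphs K' := h2 ▸ ⟨g, hg, rfl⟩
      obtain ⟨g', hg', heq⟩ := this
      -- `g` and `g'` agree on the common least support, so they differ by an element fixing it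
      -- pointwise, which lies in `K'`.
      have h3 : g'⁻¹ * g ∈ K' := (hS K' hK').1 _ fun d hd => by
        have : (d, g • d) ∈ {p : D × D | p.1 ∈ S K ∧ g • p.1 = p.2} := ⟨h1 ▸ hd, rfl⟩
        rw [heq] at this
        rw [mul_smul, ← show g' • d = g • d from this.2, inv_smul_smul]
      simpa using K'.mul_mem hg' h3
    intro K hK K' hK' h
    obtain ⟨h1, h2⟩ := Prod.ext_iff.1 h
    exact le_antisymm (hle hK' h1 h2) (hle hK h1.symm h2.symm)

theorem NomLE.orbitRank_le (hG : AdmitsLeastSupport G) {Y X : Type*} [MulAction G Y]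
    [MulAction G X] (h : NomLE G Y X) (hX : OrbitFinite G X) (hXn : IsNominal G X) :
    orbitRank G Y ≤ orbitRank G X := by
  obtain ⟨P, f, hf⟩ := h
  exact (orbitRank_le_of_surjective hX (hXn.finite_Ici_stabilizer hG) f hf).1

theorem NomLT.orbitRank_lt (hG : AdmitsLeastSupport G) {Y X : Type*} [MulAction G Y]
    [MulAction G X] (h : NomLT G Y X) (hX : OrbitFinite G X) (hXn : IsNominal G X) :
    orbitRank G Y < orbitRank G X := by
  obtain ⟨⟨P, f, hf⟩, hiso⟩ := h
  by_contra hlt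
  obtain ⟨hP, hinj⟩ := (orbitRank_le_of_surjective hX (hXn.finite_Ici_stabilizer hG) f hf).2
    (not_lt.1 hlt)
  choose s hs using hf
  -- With equal ranks `f` is total and injective, so its section `s` is the forbidden isomorphism.
  refine hiso ⟨⟨fun y => (s y : X), fun g y => ?_⟩, ?_, fun z => ?_⟩
  · exact congrArg Subtype.val (a₂ := g • s y) (hinj (by rw [hs, map_smul, hs]))
  · intro y y' h
    rw [← hs y, ← hs y']
    exact congrArg f (Subtype.ext h)
  · exact ⟨f ⟨z, hP z⟩, congrArg Subtype.val (a₂ := ⟨z, hP z⟩) (hinj (hs _))⟩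

/-- A partial equivariant surjection that is not total or not injective is strict. -/
theorem nomLT_of_factor (hG : AdmitsLeastSupport G) {T X Y : Type*} [MulAction G T]
    [MulAction G X] [MulAction G Y] (hX : OrbitFinite G X) (hXn : IsNominal G X)
    (f : T →[G] X) (g : T →[G] Y) (hg : Function.Surjective g)
    (h : ∀ s t, f s = f t → g s = g t)
    (hne : Function.Surjective f → ∃ s t, g s = g t ∧ f s ≠ f t) : NomLT G Y X := by
  have hle := nomLE_of_factor f g hg h
  refine ⟨hle, fun ⟨ψ, hψ⟩ => ?_⟩
  -- The isomorphism `ψ` may be unrelated to the induced map `φ`; it serves only to equate the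
  -- ranks, which forces `φ` to be total and injective.
  have h1 := (nomLE_of_surjective ψ hψ.2).orbitRank_le hG (hle.orbitFinite hX) (hle.isNominal hXn)
  obtain ⟨P, φ, hP, hφ⟩ := exists_partialMap_of_factor f g h
  have hφs : Function.Surjective φ := fun y => by
    obtain ⟨t, rfl⟩ := hg y
    exact ⟨⟨f t, (hP _).2 ⟨t, rfl⟩⟩, hφ _ _⟩
  obtain ⟨h2, h3⟩ := (orbitRank_le_of_surjective hX (hXn.finite_Ici_stabilizer hG) φ hφs).2 h1
  obtain ⟨s, t, hst, hne⟩ := hne fun z => (hP z).1 (h2 z)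
  exact hne (congrArg Subtype.val (@h3 ⟨f s, h2 _⟩ ⟨f t, h2 _⟩ (by rw [hφ, hφ, hst])))

/-- The length of a chain below an orbit finite nominal set is bounded by its rank. -/
theorem chain_length_le (hG : AdmitsLeastSupport G) {X : Type*} [MulAction G X]
    (hX : OrbitFinite G X) (hXn : IsNominal G X) (n : ℕ) (Z : ℕ → Type*)
    [∀ i, MulAction G (Z i)] (hZ : ∀ i < n, OrbitFinite G (Z i) ∧ IsNominal G (Z i))
    (hlt : ∀ i, i + 1 < n → NomLT G (Z i) (Z (i + 1))) (hle : ∀ i < n, NomLE G (Z i) X) :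
    n ≤ orbitRank G X + 1 := by
  have key (i : ℕ) (hi : i < n) : i ≤ orbitRank G (Z i) := by
    induction i with
    | zero => exact Nat.zero_le _
    | succ i ih =>
      have h1 := ih (by omega)
      have h2 := (hlt i hi).orbitRank_lt hG (hZ _ hi).1 (hZ _ hi).2
      omega
  rcases n with - | n
  · exact Nat.zero_le _
  · have h1 := key n n.lt_succ_self
    have h2 := (hle n n.lt_succ_self).orbitRank_le hG hX hXn
    omega

end Nominal

/-! ### Runs of automata and the syntactic congruence. -/

section Automata

variable {Γ : Type*} [Group Γ] {m : ℕ} {A : Type v} [MulAction Γ A]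

namespace DBTA

variable {Q : Type*} [MulAction Γ Q] {Q' : Type*} [MulAction Γ Q']

theorem mem_lang {M : DBTA Γ m A Q} {t : DTree m A} : t ∈ M.lang ↔ M.run t ∈ M.accept := Iff.rfl

theorem run_plug_congr (M : DBTA Γ m A Q) {s t : DTree m A} (h : M.run s = M.run t)
    (c : Ctx m A) : M.run (c.plug s) = M.run (c.plug t) := by
  induction c with
  | hole => exact h
  | node a k i b c ih =>
    simp only [Ctx.plug, run]
    congr 1
    funext j
    split_ifs
    · exact ih
    · rfl

theorem mk_eq_of_run_eq {M : DBTA Γ m A Q} {U : SubMulAction Γ (DTree m A)} (hU : M.lang = U)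
    {s t : DTree m A} (h : M.run s = M.run t) : SynState.mk U s = SynState.mk U t := by
  subst hU
  refine SynState.mk_eq.2 fun c => ?_
  rw [mem_lang, mem_lang, M.run_plug_congr h]

/-- `run` as an equivariant map. -/
def runHom (M : DBTA Γ m A Q) : DTree m A →[Γ] Q := ⟨M.run, M.run_smul⟩

/-- The partial homomorphism lives on the reachable states of `M` and sends the state of a tree in
`M` to its state in `M'`. -/
theorem Below.of_run {M' : DBTA Γ m A Q'} {M : DBTA Γ m A Q}
    (hsurj : Function.Surjective M'.run) (h : ∀ s t, M.run s = M.run t → M'.run s = M'.run t)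
    (hlang : M.lang = M'.lang) : M'.Below M := by
  obtain ⟨P, φ, hP, hφ⟩ := exists_partialMap_of_factor M.runHom M'.runHom h
  refine ⟨P, φ, fun ⟨q, hq⟩ => ?_, fun a k q => ?_, fun q' => ?_⟩
  · obtain ⟨t, rfl⟩ := (hP q).1 hq
    rw [hφ]
    exact SetLike.ext_iff.1 hlang t
  · choose t ht using fun i => (hP _).1 (q i).2
    have h1 : M.trans a k (fun i => (q i : Q)) = M.runHom (.node a k t) := by
      simp only [← ht]
      rfl
    have h2 : M.runHom (.node a k t) ∈ P := (hP _).2 ⟨_, rfl⟩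
    refine ⟨h1 ▸ h2, ?_⟩
    have h3 (i) : φ (q i) = M'.run (t i) := by
      rw [show q i = ⟨M.runHom (t i), (hP _).2 ⟨_, rfl⟩⟩ from Subtype.ext (ht i).symm, hφ]
      rfl
    simp only [h1, h3, hφ]
    rfl
  · obtain ⟨t, rfl⟩ := hsurj q'
    exact ⟨⟨M.runHom t, (hP _).2 ⟨t, rfl⟩⟩, hφ _ _⟩

theorem Iso.of_run {M : DBTA Γ m A Q} {M' : DBTA Γ m A Q'}
    (hM : Function.Surjective M.run) (hM' : Function.Surjective M'.run)
    (h : ∀ s t, M.run s = M.run t ↔ M'.run s = M'.run t)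
    (hlang : M.lang = M'.lang) : M.Iso M' := by
  choose r hr using hM
  have hφ (t : DTree m A) : M'.run (r (M.run t)) = M'.run t := (h _ _).1 (hr _)
  refine ⟨⟨fun q => M'.run (r q), fun g q => ?_⟩, ⟨fun q q' hq => ?_, fun q' => ?_⟩,
    fun q => ?_, fun a k q => ?_⟩
  · change M'.run _ = g • M'.run _
    rw [← M'.run_smul]
    refine (h _ _).1 ?_
    rw [hr, M.run_smul, hr]
  · rw [← hr q, ← hr q']
    exact (h _ _).2 hq
  · obtain ⟨t, rfl⟩ := hM' q'
    exact ⟨M.run t, hφ t⟩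
  · conv_lhs => rw [← hr q]
    exact SetLike.ext_iff.1 hlang (r q)
  · change M'.run (r (M.trans a k q)) = M'.run (.node a k fun i => r (q i))
    have := hφ (.node a k fun i => r (q i))
    simp only [run, hr] at this
    exact this

end DBTA

theorem synAutomaton_run (U : SubMulAction Γ (DTree m A)) (t : DTree m A) :
    (synAutomaton U).run t = SynState.mk U t := by
  induction t with
  | node a k t ih => simp only [DBTA.run, ih, synAutomaton_trans]

theorem synAutomaton_lang (U : SubMulAction Γ (DTree m A)) : (synAutomaton U).lang = U := by
  ext t
  rw [DBTA.mem_lang, synAutomaton_run]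
  constructor
  · rintro ⟨s, hs, h⟩
    exact (SynState.mk_eq.1 h .hole).2 hs
  · exact fun ht => ⟨t, ht, rfl⟩

theorem synAutomaton_run_surjective (U : SubMulAction Γ (DTree m A)) :
    Function.Surjective (synAutomaton U).run := fun q => by
  obtain ⟨t, rfl⟩ := q.exists_mk
  exact ⟨t, synAutomaton_run U t⟩

/-- The syntactic automaton is below every automaton that recognizes `U`. -/
theorem synState_nomLE {Q : Type*} [MulAction Γ Q] {M : DBTA Γ m A Q}
    {U : SubMulAction Γ (DTree m A)} (hU : M.lang = U) : NomLE Γ (SynState U) Q :=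
  nomLE_of_factor M.runHom (synAutomaton U).runHom (synAutomaton_run_surjective U)
    fun s t h => by
      change (synAutomaton U).run s = (synAutomaton U).run t
      rw [synAutomaton_run, synAutomaton_run]
      exact DBTA.mk_eq_of_run_eq hU h

/-! ### Rows of growing tables and the automata they define. -/

namespace ObsTable

variable {U : SubMulAction Γ (DTree m A)}

theorem rows_mono {τ τ' : ObsTable U} (hS : τ.S ≤ τ'.S) : τ.rows ⊆ τ'.rows := by
  rintro s (hs | ⟨-, a, k, s, -, hs, rfl⟩)
  · exact Or.inl (hS hs)
  · exact τ'.node_mem_rows a k s fun i => hS (hs i)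

/-- Entries record membership in `U`, so enlarging a table never changes them: an old row is the
restriction of the new one to the old contexts. -/
theorem mem_row_iff_of_le {τ τ' : ObsTable U} (hS : τ.S ≤ τ'.S) (hE : τ.E ≤ τ'.E)
    {s : DTree m A} (hs : s ∈ τ.rows) {e : Ctx m A} (he : e ∈ τ.E) :
    e ∈ τ.row s ↔ e ∈ τ'.row s := by
  simp [mem_row hs, mem_row (rows_mono hS hs), he, hE he]

theorem row_eq_of_le {τ τ' : ObsTable U} (hS : τ.S ≤ τ'.S) (hE : τ.E ≤ τ'.E)
    {s t : DTree m A} (hs : s ∈ τ.rows) (ht : t ∈ τ.rows) (h : τ'.row s = τ'.row t) :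
    τ.row s = τ.row t := by
  ext e
  by_cases he : e ∈ τ.E
  · rw [mem_row_iff_of_le hS hE hs he, mem_row_iff_of_le hS hE ht he, h]
  · simp [mem_row hs, mem_row ht, he]

/-- The row map on the labels of a smaller table. -/
def rowHom (τ τ' : ObsTable U) (hS : τ.S ≤ τ'.S) : τ.S →[Γ] τ'.rowS :=
  ⟨fun s => ⟨τ'.row s, s, hS s.2, rfl⟩, fun g s =>
    Subtype.ext (τ'.row_smul g (Or.inl (hS s.2)))⟩

theorem rowHom_surjective (τ : ObsTable U) : Function.Surjective (rowHom τ τ le_rfl) := by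
  rintro ⟨_, s, hs, rfl⟩
  exact ⟨⟨s, hs⟩, rfl⟩

theorem nomLE_of_le {τ τ' : ObsTable U} (hS : τ.S ≤ τ'.S) (hE : τ.E ≤ τ'.E) :
    NomLE Γ τ.rowS τ'.rowS :=
  nomLE_of_factor (rowHom τ τ' hS) (rowHom τ τ le_rfl) τ.rowHom_surjective fun s t h =>
    Subtype.ext (row_eq_of_le hS hE (Or.inl s.2) (Or.inl t.2) (congrArg Subtype.val h))

/-- A row tests only the contexts in `E`, while the class of a label fixes the answers for all
contexts. -/
theorem rowS_nomLE_synState (τ : ObsTable U) : NomLE Γ τ.rowS (SynState U) :=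
  nomLE_of_factor (T := τ.S) ⟨fun s => SynState.mk U s, fun _ _ => rfl⟩ (rowHom τ τ le_rfl)
    τ.rowHom_surjective fun s t h => Subtype.ext <| by
      have h' := SynState.mk_eq.1 h
      change τ.row s = τ.row t
      ext e
      rw [mem_row (Or.inl s.2), mem_row (Or.inl t.2), h' e]

theorem mem_automaton_accept {τ : ObsTable U} {hcl : τ.Closed} {hco : τ.Consistent} {q : τ.rowS} :
    q ∈ (τ.automaton hcl hco).accept ↔ Ctx.hole ∈ (q : Set (Ctx m A)) := by
  obtain ⟨_, s, hs, rfl⟩ := q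
  have hrow {r : DTree m A} (hr : r ∈ τ.S) : Ctx.hole ∈ τ.row r ↔ r ∈ U := by
    rw [mem_row (Or.inl hr)]
    exact and_iff_right τ.hole_mem
  constructor
  · rintro ⟨r, hr, ⟨_, hT⟩, h⟩
    simp only at h ⊢
    rw [h, hrow hr]
    simpa [T] using hT
  · intro h
    refine ⟨s, hs, ⟨⟨.hole, τ.hole_mem, s, Or.inl hs, rfl⟩, ?_⟩, rfl⟩
    simpa [T] using (hrow hs).1 h

/-- The children `t i` may lie outside `S`; only labels `s i` with the right rows are needed. This
serves inductions over arbitrary trees. -/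
theorem automaton_run_node {τ : ObsTable U} {hcl : τ.Closed} {hco : τ.Consistent} {a : A}
    {k : Fin (m + 1)} {t s : Fin k → DTree m A} (hs : ∀ i, s i ∈ τ.S)
    (h : ∀ i, ((τ.automaton hcl hco).run (t i) : Set (Ctx m A)) = τ.row (s i)) :
    ((τ.automaton hcl hco).run (.node a k t) : Set (Ctx m A)) = τ.row (.node a k s) := by
  rw [← τ.automaton_trans hcl hco a k s hs, DBTA.run]
  congr 2
  funext i
  exact Subtype.ext (h i)

theorem automaton_run_of_mem {τ : ObsTable U} (hcl : τ.Closed) (hco : τ.Consistent)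
    {t : DTree m A} (ht : t ∈ τ.S) :
    ((τ.automaton hcl hco).run t : Set (Ctx m A)) = τ.row t := by
  induction t with
  | node a k t ih =>
    have h (i) : t i ∈ τ.S := τ.subtree_closed _ ht _ (.child _ _ _ _ i (.refl _))
    exact automaton_run_node h fun i => ih i (h i)

theorem mem_automaton_lang_of_mem {τ : ObsTable U} (hcl : τ.Closed) (hco : τ.Consistent)
    {t : DTree m A} (ht : t ∈ τ.S) : t ∈ (τ.automaton hcl hco).lang ↔ t ∈ U := by
  rw [DBTA.mem_lang, mem_automaton_accept, automaton_run_of_mem hcl hco ht, mem_row (Or.inl ht)]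
  exact and_iff_right τ.hole_mem

theorem automaton_run_surjective {τ : ObsTable U} (hcl : τ.Closed) (hco : τ.Consistent) :
    Function.Surjective (τ.automaton hcl hco).run := by
  rintro ⟨_, s, hs, rfl⟩
  exact ⟨s, Subtype.ext (automaton_run_of_mem hcl hco hs)⟩

/-- If the automaton of a table recognizes `U`, then its states are the classes of `≈_U`. -/
theorem automaton_run_eq_iff {τ : ObsTable U} {hcl : τ.Closed} {hco : τ.Consistent}
    (hU : (τ.automaton hcl hco).lang = U) {s t : DTree m A} :
    (τ.automaton hcl hco).run s = (τ.automaton hcl hco).run t ↔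
      SynState.mk U s = SynState.mk U t := by
  refine ⟨DBTA.mk_eq_of_run_eq hU, fun h => ?_⟩
  -- The state of any tree `r` is the row of a label `r'` reaching the same state. As the automaton
  -- recognizes `U`, `r ≈_U r'`, so this row can be read off from `r` itself.
  have key (r : DTree m A) (e : Ctx m A) :
      e ∈ ((τ.automaton hcl hco).run r : Set (Ctx m A)) ↔ e ∈ τ.E ∧ e.plug r ∈ U := by
    obtain ⟨r', hr', hrow⟩ := τ.exists_rep ((τ.automaton hcl hco).run r)
    rw [← hrow, mem_row (Or.inl hr')]
    have : (τ.automaton hcl hco).run r' = (τ.automaton hcl hco).run r :=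
      Subtype.ext ((automaton_run_of_mem hcl hco hr').trans hrow)
    exact and_congr_right fun _ => SynState.mk_eq.1 (DBTA.mk_eq_of_run_eq hU this) e
  ext e
  rw [key, key, SynState.mk_eq.1 h e]

theorem automaton_below {τ : ObsTable U} {hcl : τ.Closed} {hco : τ.Consistent}
    (hU : (τ.automaton hcl hco).lang = U) {Q : Type*} [MulAction Γ Q] {M : DBTA Γ m A Q}
    (hM : M.lang = U) : (τ.automaton hcl hco).Below M :=
  .of_run (automaton_run_surjective hcl hco)
    (fun _ _ h => (automaton_run_eq_iff hU).2 (DBTA.mk_eq_of_run_eq hM h)) (hM.trans hU.symm)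

theorem automaton_iso {τ : ObsTable U} {hcl : τ.Closed} {hco : τ.Consistent}
    (hU : (τ.automaton hcl hco).lang = U) : (τ.automaton hcl hco).Iso (synAutomaton U) :=
  .of_run (automaton_run_surjective hcl hco) (synAutomaton_run_surjective U)
    (fun s t => by rw [automaton_run_eq_iff hU, synAutomaton_run, synAutomaton_run])
    (hU.trans (synAutomaton_lang U).symm)

/-- If the smaller table already has all rows of the larger one, the automata of both tables
recognize the same language. -/
theorem automaton_lang_eq {τ τ' : ObsTable U} (hcl : τ.Closed) (hco : τ.Consistent)
    (hcl' : τ'.Closed) (hco' : τ'.Consistent) (hS : τ.S ≤ τ'.S) (hE : τ.E ≤ τ'.E)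
    (hsurj : Function.Surjective (rowHom τ τ' hS)) :
    (τ.automaton hcl hco).lang = (τ'.automaton hcl' hco').lang := by
  -- Each tree has one old label describing its state in both automata. At a node, the row in `τ'`
  -- is attained by an old label by `hsurj`, and restricting rows gives the equality in `τ`.
  have key (t : DTree m A) : ∃ s ∈ τ.S, ((τ.automaton hcl hco).run t : Set (Ctx m A)) = τ.row s ∧
      ((τ'.automaton hcl' hco').run t : Set (Ctx m A)) = τ'.row s := by
    induction t with
    | node a k t ih =>
      choose s hs h h' using ih
      have hmem := τ.node_mem_rows a k s hs
      obtain ⟨⟨r, hr⟩, hrow⟩ := hsurj ⟨_, row_mem_rowS hcl' (rows_mono hS hmem)⟩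
      have hrow' : τ'.row r = τ'.row (.node a k s) := congrArg Subtype.val hrow
      refine ⟨r, hr, ?_, ?_⟩
      · rw [automaton_run_node hs h, row_eq_of_le hS hE (Or.inl hr) hmem hrow']
      · rw [automaton_run_node (fun i => hS (hs i)) h', hrow']
  ext t
  obtain ⟨s, hs, h, h'⟩ := key t
  rw [DBTA.mem_lang, DBTA.mem_lang, mem_automaton_accept, mem_automaton_accept, h, h',
    mem_row_iff_of_le hS hE (Or.inl hs) τ.hole_mem]

theorem ConsistencyExt.le {τ τ' : ObsTable U} (h : τ.ConsistencyExt τ') :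
    τ.S ≤ τ'.S ∧ τ.E ≤ τ'.E := by
  cases h
  exact ⟨le_rfl, fun _ => Or.inl⟩

theorem ClosednessExt.le {τ τ' : ObsTable U} (h : τ.ClosednessExt τ') :
    τ.S ≤ τ'.S ∧ τ.E ≤ τ'.E := by
  cases h
  exact ⟨fun _ => Or.inl, le_rfl⟩

theorem CounterexampleExt.le {τ τ' : ObsTable U} (h : τ.CounterexampleExt τ') :
    τ.S ≤ τ'.S ∧ τ.E ≤ τ'.E := by
  cases h
  exact ⟨fun _ => Or.inl, le_rfl⟩

theorem exists_consistencyExt {τ : ObsTable U} (h : ¬ τ.Consistent) :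
    ∃ τ', τ.ConsistencyExt τ' := by
  unfold Consistent at h
  push Not at h
  obtain ⟨s₁, hs₁, s₂, hs₂, hrow, a, k, i, b, hb, hne⟩ := h
  obtain ⟨e, he⟩ : ∃ e, ¬ (e ∈ τ.row ((Ctx.elementary a k i b).plug s₁) ↔
      e ∈ τ.row ((Ctx.elementary a k i b).plug s₂)) := by
    by_contra! h
    exact hne (Set.ext h)
  have heE : e ∈ τ.E := by
    by_contra heE
    exact he (iff_of_false (fun h => heE h.1) (fun h => heE h.1))
  exact ⟨_, .intro τ s₁ s₂ hs₁ hs₂ hrow e heE a k i b hb he⟩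

theorem exists_closednessExt {τ : ObsTable U} (h : ¬ τ.Closed) : ∃ τ', τ.ClosednessExt τ' := by
  unfold Closed at h
  push Not at h
  obtain ⟨t, ht, hne⟩ := h
  exact ⟨_, .intro τ t ht hne⟩

theorem exists_counterexampleExt {τ : ObsTable U} {hcl : τ.Closed} {hco : τ.Consistent}
    (h : (τ.automaton hcl hco).lang ≠ U) : ∃ τ', τ.CounterexampleExt τ' := by
  obtain ⟨t, ht⟩ : ∃ t, ¬ (t ∈ U ↔ t ∈ (τ.automaton hcl hco).lang) := by
    by_contra! h'
    exact h (SetLike.ext fun t => (h' t).symm)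
  exact ⟨_, .intro τ hcl hco t ht⟩

end ObsTable

/-! ### Monotonicity, correctness and progress of runs. -/

/-- The table of a configuration. -/
def Config.table {U : SubMulAction Γ (DTree m A)} : Config U → ObsTable U
  | .loop τ | .closedTest τ | .conjecture τ _ _ | .halted τ _ _ => τ

theorem Step.le {U : SubMulAction Γ (DTree m A)} {c c' : Config U} (h : Step c c') :
    c.table.S ≤ c'.table.S ∧ c.table.E ≤ c'.table.E := by
  cases h with
  | exitLoop | skipConsistency | skipClosedness | accepted => exact ⟨le_rfl, le_rfl⟩
  | fixConsistency _ _ _ h => exact h.le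
  | fixClosedness _ _ _ h => exact h.le
  | rejected _ _ _ _ h => exact h.le

theorem le_of_reflTransGen_step {U : SubMulAction Γ (DTree m A)} {c c' : Config U}
    (h : Relation.ReflTransGen Step c c') :
    c.table.S ≤ c'.table.S ∧ c.table.E ≤ c'.table.E := by
  induction h with
  | refl => exact ⟨le_rfl, le_rfl⟩
  | tail _ h ih => exact ⟨ih.1.trans h.le.1, ih.2.trans h.le.2⟩

theorem Config.Reachable.lang_eq {U : SubMulAction Γ (DTree m A)} {hA : OrbitFinite Γ A}
    {τ : ObsTable U} {hcl : τ.Closed} {hco : τ.Consistent}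
    (h : Config.Reachable U hA (.halted τ hcl hco)) : (τ.automaton hcl hco).lang = U := by
  rcases Relation.ReflTransGen.cases_tail h with h | ⟨c, -, h⟩
  · cases h
  · cases h with
    | accepted _ _ _ h => exact h

theorem exists_step_or_halted {U : SubMulAction Γ (DTree m A)} (c : Config U) :
    (∃ c', Step c c') ∨ ∃ τ hcl hco, c = Config.halted τ hcl hco := by
  cases c with
  | loop τ =>
    left
    by_cases hco : τ.Consistent
    · by_cases hcl : τ.Closed
      · exact ⟨_, .exitLoop τ hcl hco⟩
      · exact ⟨_, .skipConsistency τ hco hcl⟩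
    · obtain ⟨τ', h⟩ := ObsTable.exists_consistencyExt hco
      exact ⟨_, .fixConsistency τ τ' hco h⟩
  | closedTest τ =>
    left
    by_cases hcl : τ.Closed
    · exact ⟨_, .skipClosedness τ hcl⟩
    · obtain ⟨τ', h⟩ := ObsTable.exists_closednessExt hcl
      exact ⟨_, .fixClosedness τ τ' hcl h⟩
  | conjecture τ hcl hco =>
    left
    by_cases h : (τ.automaton hcl hco).lang = U
    · exact ⟨_, .accepted τ hcl hco h⟩
    · obtain ⟨τ', h⟩ := ObsTable.exists_counterexampleExt h
      exact ⟨_, .rejected τ τ' hcl hco h⟩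
  | halted τ hcl hco => exact Or.inr ⟨τ, hcl, hco, rfl⟩

end Automata

/-! ### Strict growth of `row(S)` and termination. -/

section NominalAutomata

variable {D : Type u} {G : Subgroup (Equiv.Perm D)} {m : ℕ} {A : Type v} [MulAction G A]
  {U : SubMulAction G (DTree m A)}

theorem IsRecognizableNominal.synState (hU : IsRecognizableNominal.{w} U) :
    OrbitFinite G (SynState U) ∧ IsNominal G (SynState U) := by
  obtain ⟨Q, _, M, ⟨-, hQ, hQn⟩, hM⟩ := hU
  have h := synState_nomLE hM
  exact ⟨h.orbitFinite hQ, h.isNominal hQn⟩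

namespace ObsTable

theorem orbitFinite_rowS (hU : IsRecognizableNominal.{w} U) (τ : ObsTable U) :
    OrbitFinite G τ.rowS :=
  τ.rowS_nomLE_synState.orbitFinite hU.synState.1

theorem isNominal_rowS (hU : IsRecognizableNominal.{w} U) (τ : ObsTable U) :
    IsNominal G τ.rowS :=
  τ.rowS_nomLE_synState.isNominal hU.synState.2

/-- Restriction of rows fails to be a bijection in two ways: some new row has no old label, or two
new rows restrict to the same old one. Either suffices. -/
theorem nomLT_of_le (hG : AdmitsLeastSupport G) (hU : IsRecognizableNominal.{w} U)
    {τ τ' : ObsTable U} (hS : τ.S ≤ τ'.S) (hE : τ.E ≤ τ'.E)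
    (hne : Function.Surjective (rowHom τ τ' hS) →
      ∃ s ∈ τ.S, ∃ t ∈ τ.S, τ.row s = τ.row t ∧ τ'.row s ≠ τ'.row t) :
    NomLT G τ.rowS τ'.rowS := by
  refine nomLT_of_factor hG (τ'.orbitFinite_rowS hU) (τ'.isNominal_rowS hU) (rowHom τ τ' hS)
    (rowHom τ τ le_rfl) τ.rowHom_surjective (fun s t h => Subtype.ext
      (row_eq_of_le hS hE (Or.inl s.2) (Or.inl t.2) (congrArg Subtype.val h))) fun h => ?_
  obtain ⟨s, hs, t, ht, h1, h2⟩ := hne h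
  exact ⟨⟨s, hs⟩, ⟨t, ht⟩, Subtype.ext h1, fun h => h2 (congrArg Subtype.val h)⟩

theorem ConsistencyExt.nomLT (hG : AdmitsLeastSupport G) (hU : IsRecognizableNominal.{w} U)
    {τ τ' : ObsTable U} (h : τ.ConsistencyExt τ') : NomLT G τ.rowS τ'.rowS := by
  refine nomLT_of_le hG hU h.le.1 h.le.2 fun _ => ?_
  obtain ⟨s₁, s₂, hs₁, hs₂, hrow, e, he, a, k, i, b, hb, hne⟩ := h
  refine ⟨s₁, hs₁, s₂, hs₂, hrow, fun h => hne ?_⟩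
  have hnode {s : DTree m A} (hs : s ∈ τ.S) : (Ctx.elementary a k i b).plug s ∈ τ.rows := by
    refine τ.node_mem_rows a k _ fun j => ?_
    split_ifs
    exacts [hs, hb _]
  set τ' := τ.addContext e he a k i b hb
  -- The added context tests `s₁` and `s₂` just as `e` tests the trees built over them, where the
  -- answers differ.
  have h' := Set.ext_iff.1 h (e.comp (Ctx.elementary a k i b))
  have hmem : e.comp (Ctx.elementary a k i b) ∈ τ'.E :=
    Or.inr ⟨_, rfl, 1, one_smul _ _⟩
  rw [mem_row (τ := τ') (Or.inl hs₁), mem_row (τ := τ') (Or.inl hs₂), and_iff_right hmem,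
    and_iff_right hmem, plug_comp, plug_comp] at h'
  rw [mem_row (hnode hs₁), mem_row (hnode hs₂), h']

theorem ClosednessExt.nomLT (hG : AdmitsLeastSupport G) (hU : IsRecognizableNominal.{w} U)
    {τ τ' : ObsTable U} (h : τ.ClosednessExt τ') : NomLT G τ.rowS τ'.rowS := by
  refine nomLT_of_le hG hU h.le.1 h.le.2 fun hsurj => ?_
  have hle := h.le
  obtain ⟨t, ht, hne⟩ := h
  have htS : t ∈ (τ.addRow t ht).S := Or.inr ⟨t, rfl, 1, one_smul _ _⟩
  obtain ⟨⟨s, hs⟩, h⟩ := hsurj ⟨_, t, htS, rfl⟩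
  -- An old label sharing the new row of `t` would already have shared its old row.
  exact absurd (row_eq_of_le hle.1 hle.2 (Or.inl hs) (Or.inr ht) (congrArg Subtype.val h)).symm
    (hne s hs)

/-- A counterexample makes every later closed and consistent table strictly larger. -/
theorem CounterexampleExt.nomLT_of_le (hG : AdmitsLeastSupport G)
    (hU : IsRecognizableNominal.{w} U) {τ τ₁ τ' : ObsTable U} (h : τ.CounterexampleExt τ₁)
    (hS : τ₁.S ≤ τ'.S) (hE : τ₁.E ≤ τ'.E) (hcl' : τ'.Closed) (hco' : τ'.Consistent) :
    NomLT G τ.rowS τ'.rowS := by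
  refine ObsTable.nomLT_of_le hG hU (h.le.1.trans hS) (h.le.2.trans hE) fun hsurj => ?_
  have hle := h.le
  obtain ⟨hcl, hco, t, ht⟩ := h
  have htS : t ∈ τ'.S := hS (Or.inr ⟨t, .refl t, 1, one_smul _ _⟩)
  rw [automaton_lang_eq hcl hco hcl' hco' (hle.1.trans hS) (hle.2.trans hE) hsurj,
    mem_automaton_lang_of_mem hcl' hco' htS] at ht
  exact absurd Iff.rfl ht

end ObsTable

/-- The first step must be a rejection, as nothing follows `halted`; its counterexample remains a
label in all later tables. -/
theorem nomLT_of_transGen_conjecture (hG : AdmitsLeastSupport G)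
    (hU : IsRecognizableNominal.{w} U) {τ τ' : ObsTable U} {hcl : τ.Closed} {hco : τ.Consistent}
    {hcl' : τ'.Closed} {hco' : τ'.Consistent}
    (h : Relation.TransGen Step (Config.conjecture τ hcl hco) (Config.conjecture τ' hcl' hco')) :
    NomLT G τ.rowS τ'.rowS := by
  obtain ⟨c, h1, h2⟩ := Relation.TransGen.head'_iff.1 h
  cases h1 with
  | rejected _ τ₁ _ _ h =>
    have hle := le_of_reflTransGen_step h2
    exact h.nomLT_of_le hG hU hle.1 hle.2 hcl' hco'
  | accepted =>
    rcases Relation.ReflTransGen.cases_head h2 with h | ⟨_, h, -⟩ <;> cases h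

open Classical in
/-- Bounds the number of steps that leave the table unchanged. -/
noncomputable def Config.weight : Config U → ℕ
  -- A closed, consistent table passes through 5, 4, 3, 0 and an unclosed, consistent one through 2,
  -- 1. A rejection that keeps the rank leads from 3 to 2, because the new table is then not both
  -- closed and consistent.
  | .loop τ => if τ.Closed ∧ τ.Consistent then 4 else 2
  | .closedTest τ => if τ.Closed then 5 else 1
  | .conjecture _ _ _ => 3
  | .halted _ _ _ => 0

theorem Config.weight_le (c : Config U) : c.weight ≤ 5 := by
  cases c <;> simp only [Config.weight] <;> (try split_ifs) <;> omega

/-- Every step increases the rank of `row(S)`, or preserves it and decreases the weight. -/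
theorem Step.rank_or_weight (hG : AdmitsLeastSupport G) (hU : IsRecognizableNominal.{w} U)
    {c c' : Config U} (h : Step c c') :
    orbitRank G c.table.rowS < orbitRank G c'.table.rowS ∨
      orbitRank G c.table.rowS = orbitRank G c'.table.rowS ∧ c'.weight < c.weight := by
  have hlt {τ τ' : ObsTable U} (h : NomLT G τ.rowS τ'.rowS) :
      orbitRank G τ.rowS < orbitRank G τ'.rowS :=
    h.orbitRank_lt hG (τ'.orbitFinite_rowS hU) (τ'.isNominal_rowS hU)
  cases h with
  | exitLoop τ hcl hco => exact Or.inr ⟨rfl, by simp [Config.weight, hcl, hco]⟩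
  | fixConsistency τ τ' hco h => exact Or.inl (hlt (h.nomLT hG hU))
  | skipConsistency τ hco hcl => exact Or.inr ⟨rfl, by simp [Config.weight, hcl]⟩
  | fixClosedness τ τ' hcl h => exact Or.inl (hlt (h.nomLT hG hU))
  | skipClosedness τ hcl =>
    refine Or.inr ⟨rfl, ?_⟩
    simp only [Config.weight, hcl]
    split_ifs <;> simp_all
  | rejected τ τ' hcl hco h =>
    by_cases hτ : τ'.Closed ∧ τ'.Consistent
    · exact Or.inl (hlt (h.nomLT_of_le hG hU le_rfl le_rfl hτ.1 hτ.2))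
    · have h1 := (ObsTable.nomLE_of_le h.le.1 h.le.2).orbitRank_le hG (τ'.orbitFinite_rowS hU)
        (τ'.isNominal_rowS hU)
      exact h1.lt_or_eq.imp_right fun h2 => ⟨h2, by simp [Config.weight, hτ]⟩
  | accepted τ hcl hco h => exact Or.inr ⟨rfl, by simp [Config.weight]⟩

theorem not_forall_step (hG : AdmitsLeastSupport G) (hU : IsRecognizableNominal.{w} U)
    (run : ℕ → Config U) : ¬ ∀ n, Step (run n) (run (n + 1)) := by
  intro h
  -- The factor 6 exceeds the maximal weight 5, so a gain in rank outweighs any rise in weight and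
  -- every step raises the right side by at least 1.
  have key (n : ℕ) : n ≤ 6 * orbitRank G (run n).table.rowS + 5 - (run n).weight := by
    induction n with
    | zero => exact Nat.zero_le _
    | succ n ih =>
      have h1 := (h n).rank_or_weight hG hU
      have h2 := (run n).weight_le
      have h3 := (run (n + 1)).weight_le
      omega
  have h1 := key (6 * orbitRank G (SynState U) + 6)
  have h2 := (run (6 * orbitRank G (SynState U) + 6)).table.rowS_nomLE_synState.orbitRank_le hG
    hU.synState.1 hU.synState.2
  omega

end NominalAutomata

end NominalTree

theorem mainTheorem3 {D : Type u} [Countable D] (G : Subgroup (Equiv.Perm D))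
    (hG : AdmitsLeastSupport G) (m : ℕ) (A : Type v) [MulAction G A]
    (hAfin : OrbitFinite G A) (hAnom : IsNominal G A)
    (U : SubMulAction G (DTree m A)) (hU : IsRecognizableNominal.{w} U) :
    -- The algorithm has no infinite run.
    (∀ run : ℕ → Config U, run 0 = Config.start U hAfin →
      ¬ ∀ n, Step (run n) (run (n + 1))) ∧
    -- It stops only by returning an automaton.
    (∀ c : Config U, Config.Reachable U hAfin c →
      (∃ c', Step c c') ∨ ∃ τ hcl hco, c = Config.halted τ hcl hco) ∧
    -- The returned automaton is the minimum G-DBNTA recognizing `U`.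
    (∀ (τ : ObsTable U) (hcl : τ.Closed) (hco : τ.Consistent),
      Config.Reachable U hAfin (Config.halted τ hcl hco) →
        (τ.automaton hcl hco).IsDBNTA ∧
        (τ.automaton hcl hco).lang = U ∧
        (∀ (Q : Type w') [MulAction G Q] (M : DBTA G m A Q), M.IsDBNTA → M.lang = U →
          (τ.automaton hcl hco).Below M) ∧
        (τ.automaton hcl hco).Iso (synAutomaton U)) ∧
    -- The syntactic automaton is a G-DBNTA recognizing `U`, and `row(S) ≼ Q_U` for every table.
    ((synAutomaton U).IsDBNTA ∧ (synAutomaton U).lang = U) ∧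
    (∀ τ : ObsTable U, NomLE G τ.rowS (SynState U)) ∧
    -- Every extension in the while loop strictly increases `row(S)`.
    (∀ τ τ' : ObsTable U, τ.ConsistencyExt τ' → NomLT G τ.rowS τ'.rowS) ∧
    (∀ τ τ' : ObsTable U, τ.ClosednessExt τ' → NomLT G τ.rowS τ'.rowS) ∧
    -- An extension by a counterexample does not decrease `row(S)`; it strictly increases `row(S)`
    -- unless it makes the table non-closed or inconsistent.
    (∀ τ τ' : ObsTable U, τ.CounterexampleExt τ' →
      NomLE G τ.rowS τ'.rowS ∧ (τ'.Closed → τ'.Consistent → NomLT G τ.rowS τ'.rowS)) ∧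
    -- `row(S)` strictly increases from each conjecture to every later one.
    (∀ (τ τ' : ObsTable U) (hcl : τ.Closed) (hco : τ.Consistent) (hcl' : τ'.Closed)
      (hco' : τ'.Consistent),
      Relation.TransGen Step (Config.conjecture τ hcl hco) (Config.conjecture τ' hcl' hco') →
        NomLT G τ.rowS τ'.rowS) ∧
    -- The lengths of the chains of orbit finite nominal sets below an orbit finite nominal set are
    -- bounded.
    (∀ (X : Type x) [MulAction G X], OrbitFinite G X → IsNominal G X →
      ∃ N : ℕ, ∀ (n : ℕ) (Z : ℕ → Type x') [∀ i, MulAction G (Z i)],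
        (∀ i < n, OrbitFinite G (Z i) ∧ IsNominal G (Z i)) →
        (∀ i, i + 1 < n → NomLT G (Z i) (Z (i + 1))) →
        (∀ i < n, NomLE G (Z i) X) → n ≤ N) := by
  have hsyn := hU.synState
  refine ⟨fun run _ => not_forall_step hG hU run, fun c _ => exists_step_or_halted c,
    fun τ hcl hco h => ?_, ⟨⟨⟨hAfin, hAnom⟩, hsyn⟩, synAutomaton_lang U⟩,
    fun τ => τ.rowS_nomLE_synState, fun τ τ' h => h.nomLT hG hU, fun τ τ' h => h.nomLT hG hU,
    fun τ τ' h => ⟨ObsTable.nomLE_of_le h.le.1 h.le.2,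
      fun hcl hco => h.nomLT_of_le hG hU le_rfl le_rfl hcl hco⟩,
    fun τ τ' hcl hco hcl' hco' h => nomLT_of_transGen_conjecture hG hU h,
    fun X _ hX hXn => ⟨orbitRank G X + 1, fun n Z _ => chain_length_le hG hX hXn n Z⟩⟩
  have hlang := h.lang_eq
  exact ⟨⟨⟨hAfin, hAnom⟩, τ.orbitFinite_rowS hU, τ.isNominal_rowS hU⟩, hlang,
    fun Q _ M _ hM => ObsTable.automaton_below hlang hM, ObsTable.automaton_iso hlang⟩
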